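/- Let $n\ge 1$ be an integer and let $F=F_n(x,t)$ be a polynomial in $x$ and $t$ with real coefficients, of degree $n(n+1)$ in $x$, of degree $n(n+1)$ in $t$ and of total degree $n(n+1)$, with no zeros in $\mathbb{R}^2$. Put $$u_n=2\,\frac{\partial^2}{\partial x^2}\ln|F_n|,\qquad v_n=-2\,\frac{\partial^2}{\partial x\,\partial t}\ln|F_n|,$$ and suppose that $(u,v)=(u_n,v_n)$ satisfies the Boussinesq system $$u_t+v_x=0,\qquad v_t+(u^2)_x-u_x+\tfrac13u_{xxx}=0$$ on $\mathbb{R}^2$. Then $v_n^2$ is integrable over $\mathbb{R}^2$ and $$\frac1{8\pi}\int_{-\infty}^{\infty}\int_{-\infty}^{\infty}v_n^2(x,t)\,dx\,dt=\tfrac16\,n(n+1).$$ -/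

import Mathlib

open MeasureTheory

namespace Boussinesq

/-- The partial derivative with respect to the first variable `x`. -/
noncomputable def pdx (f : ℝ → ℝ → ℝ) : ℝ → ℝ → ℝ := fun x t => deriv (fun y => f y t) x

/-- The partial derivative with respect to the second variable `t`. -/
noncomputable def pdt (f : ℝ → ℝ → ℝ) : ℝ → ℝ → ℝ := fun x t => deriv (fun s => f x s) t

/-- The value `F(x,t)` of a real polynomial in two variables; variable `0` is `x`, variable `1`
is `t`. -/
noncomputable def val (F : MvPolynomial (Fin 2) ℝ) : ℝ → ℝ → ℝ :=
  fun x t => MvPolynomial.eval ![x, t] F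

/-- The function `ln F`. -/
noncomputable def logVal (F : MvPolynomial (Fin 2) ℝ) : ℝ → ℝ → ℝ :=
  fun x t => Real.log (val F x t)

/-- `u = 2 (ln F)_xx`. -/
noncomputable def uField (F : MvPolynomial (Fin 2) ℝ) : ℝ → ℝ → ℝ :=
  fun x t => 2 * pdx (pdx (logVal F)) x t

/-- `v = -2 (ln F)_xt`. -/
noncomputable def vField (F : MvPolynomial (Fin 2) ℝ) : ℝ → ℝ → ℝ :=
  fun x t => -2 * pdx (pdt (logVal F)) x t

/-- `(u, v)` solves `u_t + v_x = 0`, `v_t + (u²)_x - u_x + (1/3) u_xxx = 0` at every point of the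
plane. -/
def SolvesSystem (u v : ℝ → ℝ → ℝ) : Prop :=
  ∀ x t : ℝ,
    pdt u x t + pdx v x t = 0 ∧
    pdt v x t + pdx (fun y s => u y s ^ 2) x t - pdx u x t
      + (1 / 3) * pdx (pdx (pdx u)) x t = 0

/-- `F` is a real polynomial of degree `n(n+1)` in `x`, of degree `n(n+1)` in `t` and of total
degree `n(n+1)`, without real zeros, such that `u = 2 (ln F)_xx` and `v = -2 (ln F)_xt` solve the
Boussinesq system. No decay condition is imposed on `u` and `v`. -/
structure IsRationalSolution (n : ℕ) (F : MvPolynomial (Fin 2) ℝ) : Prop where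
  degree_x : F.degreeOf 0 = n * (n + 1)
  degree_t : F.degreeOf 1 = n * (n + 1)
  totalDegree : F.totalDegree = n * (n + 1)
  ne_zero : ∀ x t : ℝ, val F x t ≠ 0
  solves : SolvesSystem (uField F) (vField F)

end Boussinesq

namespace Boussinesq

open MvPolynomial

/-! ### Polynomials in two variables as functions on the plane -/

/-! Write `w = ln|F|` and `N = n(n+1)`. The second equation of the system says that `E = 3w_tt -
6w_xx² + 3w_xx - w_xxxx` has zero `x`-derivative. Degree counts give decay of `E` along horizontal
lines, so `E = 0` (`bilinear_eq_zero`).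

Hence `3Δw = 6w_xx² + w_xxxx` has order 4 at infinity, not just 2. So the numerator of `Δ ln F`
loses its top degree, and the logarithm of the top form of `F` is harmonic. This forces the form to
be `c(x²+t²)^m` with `N = 2m` (`logLaplace_eq_zero_of_isHomogeneous`). So `|F|` is bounded below by
a multiple of `(1+r²)^m`, orders become pointwise bounds, and `w` behaves like `N ln r`.

The integral is a Pohozaev identity. `E_xx` is the variational derivative of `(3/2)w_xt² +
(3/2)w_xx² - 2w_xx³ + (1/2)w_xxx²`. Under `(x,t) ↦ (λx, λ⁵t)` the integrals of the last two terms
are invariant, while those of `w_xt²` and `w_xx²` scale with exponents 6 and -2. So `18w_xt² -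
6w_xx²` is a divergence on solutions. As `6w_xx² = 3Δw - w_xxxx`, the only flux surviving at
infinity is that of `3∇w`, namely `6πN` (`eighteen_mul_sq_eq`, `exists_flux`). Therefore `∫w_xt² =
πN/3`, and `v² = 4w_xt²`.

All functions involved lie in one algebra of fractions with denominators powers of `F·(1+x²+t²)`;
the second factor is there so that `1/(1+x²+t²)` belongs to it. -/

theorem hasDerivAt_val_fst (P : MvPolynomial (Fin 2) ℝ) (x t : ℝ) :
    HasDerivAt (fun y => val P y t) (val (pderiv 0 P) x t) x := by
  induction P using MvPolynomial.induction_on with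
  | C a => simpa [val] using hasDerivAt_const x a
  | add p q hp hq => simpa [val] using hp.fun_add hq
  | mul_X p i hp =>
    have hX : HasDerivAt (fun y => val (X i) y t) (val (pderiv 0 (X i)) x t) x := by
      fin_cases i
      · simpa [val] using hasDerivAt_id' x
      · simpa [val, pderiv_X] using hasDerivAt_const x t
    have h := hp.fun_mul hX
    simp only [val, Derivation.leibniz, smul_eq_mul, map_add, map_mul] at h ⊢
    refine h.congr_deriv ?_
    ring

theorem hasDerivAt_val_snd (P : MvPolynomial (Fin 2) ℝ) (x t : ℝ) :
    HasDerivAt (fun s => val P x s) (val (pderiv 1 P) x t) t := by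
  induction P using MvPolynomial.induction_on with
  | C a => simpa [val] using hasDerivAt_const t a
  | add p q hp hq => simpa [val] using hp.fun_add hq
  | mul_X p i hp =>
    have hX : HasDerivAt (fun s => val (X i) x s) (val (pderiv 1 (X i)) x t) t := by
      fin_cases i
      · simpa [val, pderiv_X] using hasDerivAt_const t x
      · simpa [val] using hasDerivAt_id' t
    have h := hp.fun_mul hX
    simp only [val, Derivation.leibniz, smul_eq_mul, map_add, map_mul] at h ⊢
    refine h.congr_deriv ?_
    ring

theorem val_add (P Q : MvPolynomial (Fin 2) ℝ) (x t : ℝ) :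
    val (P + Q) x t = val P x t + val Q x t := by simp [val]

theorem val_mul (P Q : MvPolynomial (Fin 2) ℝ) (x t : ℝ) :
    val (P * Q) x t = val P x t * val Q x t := by simp [val]

theorem val_pow (P : MvPolynomial (Fin 2) ℝ) (m : ℕ) (x t : ℝ) :
    val (P ^ m) x t = val P x t ^ m := by simp [val]

theorem val_sub (P Q : MvPolynomial (Fin 2) ℝ) (x t : ℝ) :
    val (P - Q) x t = val P x t - val Q x t := by simp [val]

theorem val_X_one (x t : ℝ) : val (X 1) x t = t := by simp [val]

theorem val_C (c x t : ℝ) : val (C c) x t = c := by simp [val]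

theorem eq_of_val_eq {P Q : MvPolynomial (Fin 2) ℝ} (h : ∀ x t, val P x t = val Q x t) :
    P = Q := by
  refine MvPolynomial.funext fun v => ?_
  have hv : v = ![v 0, v 1] := by ext i; fin_cases i <;> rfl
  rw [hv]
  exact h _ _

theorem continuous_val (P : MvPolynomial (Fin 2) ℝ) :
    Continuous fun p : ℝ × ℝ => val P p.1 p.2 := by
  unfold val
  refine (MvPolynomial.continuous_eval P).comp ?_
  refine continuous_pi fun i => ?_
  fin_cases i
  · exact continuous_fst
  · exact continuous_snd

/-- All monomials of `P` have degree at most the integer `d`; for `d < 0` this says `P = 0`. -/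
def DegLE (P : MvPolynomial (Fin 2) ℝ) (d : ℤ) : Prop :=
  ∀ s ∈ P.support, (s.degree : ℤ) ≤ d

theorem DegLE.mono {P : MvPolynomial (Fin 2) ℝ} {d e : ℤ} (h : DegLE P d) (hde : d ≤ e) :
    DegLE P e := fun s hs => (h s hs).trans hde

theorem degLE_zero (d : ℤ) : DegLE 0 d := fun s hs => by simp at hs

theorem DegLE.add {P Q : MvPolynomial (Fin 2) ℝ} {d : ℤ} (hP : DegLE P d) (hQ : DegLE Q d) :
    DegLE (P + Q) d := fun s hs => by
  rcases Finset.mem_union.1 (MvPolynomial.support_add hs) with h | h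
  exacts [hP s h, hQ s h]

theorem DegLE.neg {P : MvPolynomial (Fin 2) ℝ} {d : ℤ} (hP : DegLE P d) : DegLE (-P) d :=
  fun s hs => hP s (by simpa using hs)

theorem DegLE.sub {P Q : MvPolynomial (Fin 2) ℝ} {d : ℤ} (hP : DegLE P d) (hQ : DegLE Q d) :
    DegLE (P - Q) d := sub_eq_add_neg P Q ▸ hP.add hQ.neg

theorem DegLE.mul {P Q : MvPolynomial (Fin 2) ℝ} {d e : ℤ} (hP : DegLE P d) (hQ : DegLE Q e) :
    DegLE (P * Q) (d + e) := fun s hs => by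
  obtain ⟨a, ha, b, hb, rfl⟩ := Finset.mem_add.1 (MvPolynomial.support_mul P Q hs)
  have h1 := hP a ha
  have h2 := hQ b hb
  rw [map_add]
  push_cast
  linarith

theorem degLE_monomial (s : Fin 2 →₀ ℕ) (c : ℝ) : DegLE (monomial s c) s.degree := fun r hr => by
  have := MvPolynomial.support_monomial_subset hr
  rw [Finset.mem_singleton] at this
  rw [this]

theorem degLE_C (c : ℝ) : DegLE (C c) 0 := by
  simpa using degLE_monomial 0 c

theorem degLE_X (i : Fin 2) : DegLE (X i) 1 := by
  simpa [X] using degLE_monomial (Finsupp.single i 1) 1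

theorem DegLE.pow {P : MvPolynomial (Fin 2) ℝ} {d : ℤ} (hP : DegLE P d) (m : ℕ) :
    DegLE (P ^ m) (m * d) := by
  induction m with
  | zero => simpa using degLE_C 1
  | succ m ih =>
    rw [pow_succ]
    exact (ih.mul hP).mono (by push_cast; linarith)

theorem DegLE.C_mul {P : MvPolynomial (Fin 2) ℝ} {d : ℤ} (hP : DegLE P d) (c : ℝ) :
    DegLE (C c * P) d := ((degLE_C c).mul hP).mono (by simp)

theorem degLE_sum {ι : Type*} {S : Finset ι} {f : ι → MvPolynomial (Fin 2) ℝ} {d : ℤ}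
    (h : ∀ i ∈ S, DegLE (f i) d) : DegLE (∑ i ∈ S, f i) d := by
  classical
  induction S using Finset.induction_on with
  | empty => simpa using degLE_zero d
  | insert i S hi ih =>
    rw [Finset.sum_insert hi]
    exact (h i (Finset.mem_insert_self i S)).add
      (ih fun j hj => h j (Finset.mem_insert_of_mem hj))

theorem DegLE.pderiv {P : MvPolynomial (Fin 2) ℝ} {d : ℤ} (hP : DegLE P d) (i : Fin 2) :
    DegLE (pderiv i P) (d - 1) := by
  rw [P.as_sum, map_sum]
  refine degLE_sum fun s hs => ?_
  rw [pderiv_monomial]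
  by_cases h : s i = 0
  · simpa [h] using degLE_zero _
  · refine (degLE_monomial _ _).mono ?_
    have hle : Finsupp.single i 1 ≤ s := by simpa [Nat.one_le_iff_ne_zero] using h
    have h1 : s.degree = (s - Finsupp.single i 1).degree + 1 := by
      conv_lhs => rw [← tsub_add_cancel_of_le hle]
      rw [map_add, Finsupp.degree_single]
    have := hP s hs
    omega

theorem degLE_totalDegree (P : MvPolynomial (Fin 2) ℝ) : DegLE P P.totalDegree := fun s hs => by
  have := MvPolynomial.le_totalDegree hs
  exact_mod_cast this

theorem DegLE.totalDegree_le {P : MvPolynomial (Fin 2) ℝ} {d : ℤ} (hP : DegLE P d) (h0 : P ≠ 0) :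
    (P.totalDegree : ℤ) ≤ d := by
  obtain ⟨s, hs, h⟩ := Finset.exists_mem_eq_sup P.support (by simpa using h0)
    (fun s => s.sum fun _ e => e)
  have := hP s hs
  unfold MvPolynomial.totalDegree
  rw [h]
  exact_mod_cast this

/-- Total degrees add over a domain, so a nonzero factor can be cancelled from a degree bound. -/
theorem DegLE.of_mul_right {P Q : MvPolynomial (Fin 2) ℝ} {d : ℤ} (h : DegLE (P * Q) d)
    (hQ : Q ≠ 0) : DegLE P (d - Q.totalDegree) := by
  by_cases hP : P = 0
  · simpa [hP] using degLE_zero _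
  · have h1 := h.totalDegree_le (mul_ne_zero hP hQ)
    rw [MvPolynomial.totalDegree_mul_of_isDomain hP hQ] at h1
    exact (degLE_totalDegree P).mono (by push_cast at h1; linarith)

end Boussinesq

namespace Boussinesq

open MvPolynomial

/-! ### Rational functions with denominators a power of `G` -/

/-- The algebra of functions `P / G ^ m` on the plane. -/
noncomputable def ratAlg (G : MvPolynomial (Fin 2) ℝ) : Subalgebra ℝ (ℝ → ℝ → ℝ) where
  carrier := {f | ∃ (P : MvPolynomial (Fin 2) ℝ) (m : ℕ), ∀ x t,
    f x t * val G x t ^ m = val P x t}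
  mul_mem' := by
    rintro f g ⟨P, m, hf⟩ ⟨Q, k, hg⟩
    refine ⟨P * Q, m + k, fun x t => ?_⟩
    simp only [val_mul, ← hf, ← hg, Pi.mul_apply]
    ring
  add_mem' := by
    rintro f g ⟨P, m, hf⟩ ⟨Q, k, hg⟩
    refine ⟨P * G ^ k + Q * G ^ m, m + k, fun x t => ?_⟩
    simp only [val_mul, val_add, val_pow, ← hf, ← hg, Pi.add_apply]
    ring
  algebraMap_mem' c := ⟨C c, 0, fun x t => by simp [val_C]⟩

variable {G : MvPolynomial (Fin 2) ℝ}

/-- A polynomial as an element of `ratAlg G`. -/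
noncomputable def poly (G : MvPolynomial (Fin 2) ℝ) : MvPolynomial (Fin 2) ℝ →ₐ[ℝ] ratAlg G where
  toFun P := ⟨val P, P, 0, fun x t => by simp⟩
  map_one' := by ext; simp [val]
  map_mul' P Q := by ext; simp [val]
  map_zero' := by ext; simp [val]
  map_add' P Q := by ext; simp [val]
  commutes' c := by ext; simp [val]

theorem coe_poly (P : MvPolynomial (Fin 2) ℝ) : (poly G P : ℝ → ℝ → ℝ) = val P := rfl

theorem ratAlg_ext {f g : ratAlg G} (h : ∀ x t, (f : ℝ → ℝ → ℝ) x t = (g : ℝ → ℝ → ℝ) x t) :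
    f = g := Subtype.ext (funext fun x => funext fun t => h x t)

theorem poly_injective : Function.Injective (poly G) := fun _ _ h =>
  eq_of_val_eq fun x t => congrFun (congrFun (congrArg Subtype.val h) x) t

theorem exists_mul_pow_eq_poly (f : ratAlg G) : ∃ P m, f * poly G G ^ m = poly G P := by
  obtain ⟨P, m, h⟩ := f.2
  exact ⟨P, m, ratAlg_ext fun x t => by simpa [coe_poly] using h x t⟩

theorem eq_zero_of_mul_poly (P : MvPolynomial (Fin 2) ℝ) (hP : ∀ x t, val P x t ≠ 0)
    {f : ratAlg G} (h : f * poly G P = 0) : f = 0 := ratAlg_ext fun x t => by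
  have := congrFun (congrFun (congrArg Subtype.val h) x) t
  simpa [coe_poly, hP x t] using this

/-- The fraction `P / G` -/
noncomputable def frac (hG : ∀ x t, val G x t ≠ 0) (P : MvPolynomial (Fin 2) ℝ) : ratAlg G :=
  ⟨fun x t => val P x t / val G x t, P, 1, fun x t => by have := hG x t; field_simp⟩

theorem frac_mul_poly (hG : ∀ x t, val G x t ≠ 0) (P : MvPolynomial (Fin 2) ℝ) :
    frac hG P * poly G G = poly G P := ratAlg_ext fun x t => by
  have := hG x t
  simp [frac, coe_poly, this]

theorem hasDerivAt_of_mul_pow {f g p : ℝ → ℝ} {g' p' x : ℝ} {m : ℕ}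
    (h : ∀ y, f y * g y ^ m = p y) (hg0 : ∀ y, g y ≠ 0) (hg : HasDerivAt g g' x)
    (hp : HasDerivAt p p' x) :
    HasDerivAt f ((p' * g x - m * p x * g') / g x ^ (m + 1)) x := by
  have hf : f = fun y => p y / g y ^ m := funext fun y => by
    rw [← h y, mul_div_cancel_right₀ _ (pow_ne_zero _ (hg0 y))]
  rw [hf]
  refine (hp.fun_div (hg.fun_pow m) (pow_ne_zero _ (hg0 x))).congr_deriv ?_
  have := hg0 x
  -- The power rule produces the truncated exponent `m - 1`, so `m = 0` is separate.
  rcases m with _ | m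
  · simp
    field_simp
  · simp only [Nat.add_sub_cancel]
    field_simp
    ring

theorem exists_pdx (hG : ∀ x t, val G x t ≠ 0) (f : ratAlg G) :
    ∃ g : ratAlg G, ∀ x t, HasDerivAt (fun y => (f : ℝ → ℝ → ℝ) y t) ((g : ℝ → ℝ → ℝ) x t) x := by
  obtain ⟨P, m, h⟩ := f.2
  refine ⟨⟨fun x t => (val (pderiv 0 P) x t * val G x t - m * val P x t * val (pderiv 0 G) x t) /
    val G x t ^ (m + 1), pderiv 0 P * G - C (m : ℝ) * P * pderiv 0 G, m + 1, fun x t => ?_⟩,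
    fun x t => hasDerivAt_of_mul_pow (fun y => h y t) (fun y => hG y t)
      (hasDerivAt_val_fst G x t) (hasDerivAt_val_fst P x t)⟩
  rw [div_mul_cancel₀ _ (pow_ne_zero _ (hG x t))]
  simp only [val_sub, val_mul, val_C]

theorem exists_pdt (hG : ∀ x t, val G x t ≠ 0) (f : ratAlg G) :
    ∃ g : ratAlg G, ∀ x t, HasDerivAt (fun s => (f : ℝ → ℝ → ℝ) x s) ((g : ℝ → ℝ → ℝ) x t) t := by
  obtain ⟨P, m, h⟩ := f.2
  refine ⟨⟨fun x t => (val (pderiv 1 P) x t * val G x t - m * val P x t * val (pderiv 1 G) x t) /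
    val G x t ^ (m + 1), pderiv 1 P * G - C (m : ℝ) * P * pderiv 1 G, m + 1, fun x t => ?_⟩,
    fun x t => hasDerivAt_of_mul_pow (fun y => h x y) (fun y => hG x y)
      (hasDerivAt_val_snd G x t) (hasDerivAt_val_snd P x t)⟩
  rw [div_mul_cancel₀ _ (pow_ne_zero _ (hG x t))]
  simp only [val_sub, val_mul, val_C]

theorem hasDerivAt_pdx (hG : ∀ x t, val G x t ≠ 0) (f : ratAlg G) (x t : ℝ) :
    HasDerivAt (fun y => (f : ℝ → ℝ → ℝ) y t) (pdx f x t) x := by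
  obtain ⟨g, hg⟩ := exists_pdx hG f
  exact (hg x t).differentiableAt.hasDerivAt

theorem hasDerivAt_pdt (hG : ∀ x t, val G x t ≠ 0) (f : ratAlg G) (x t : ℝ) :
    HasDerivAt (fun s => (f : ℝ → ℝ → ℝ) x s) (pdt f x t) t := by
  obtain ⟨g, hg⟩ := exists_pdt hG f
  exact (hg x t).differentiableAt.hasDerivAt

theorem pdx_mem (hG : ∀ x t, val G x t ≠ 0) (f : ratAlg G) : pdx f ∈ ratAlg G := by
  obtain ⟨g, hg⟩ := exists_pdx hG f
  convert g.2
  ext x t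
  exact (hg x t).deriv

theorem pdt_mem (hG : ∀ x t, val G x t ≠ 0) (f : ratAlg G) : pdt f ∈ ratAlg G := by
  obtain ⟨g, hg⟩ := exists_pdt hG f
  convert g.2
  ext x t
  exact (hg x t).deriv

/-- The derivation `∂/∂x` of the algebra `ratAlg G`. -/
noncomputable def dx (hG : ∀ x t, val G x t ≠ 0) : Derivation ℝ (ratAlg G) (ratAlg G) where
  toFun f := ⟨pdx f, pdx_mem hG f⟩
  map_add' f g := ratAlg_ext fun x t =>
    ((hasDerivAt_pdx hG f x t).fun_add (hasDerivAt_pdx hG g x t)).deriv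
  map_smul' c f := ratAlg_ext fun x t => ((hasDerivAt_pdx hG f x t).const_mul c).deriv
  map_one_eq_zero' := ratAlg_ext fun x t => (hasDerivAt_const x (1 : ℝ)).deriv
  leibniz' f g := ratAlg_ext fun x t => by
    refine ((hasDerivAt_pdx hG f x t).fun_mul (hasDerivAt_pdx hG g x t)).deriv.trans ?_
    simp
    ring

/-- The derivation `∂/∂t` of the algebra `ratAlg G`. -/
noncomputable def dt (hG : ∀ x t, val G x t ≠ 0) : Derivation ℝ (ratAlg G) (ratAlg G) where
  toFun f := ⟨pdt f, pdt_mem hG f⟩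
  map_add' f g := ratAlg_ext fun x t =>
    ((hasDerivAt_pdt hG f x t).fun_add (hasDerivAt_pdt hG g x t)).deriv
  map_smul' c f := ratAlg_ext fun x t => ((hasDerivAt_pdt hG f x t).const_mul c).deriv
  map_one_eq_zero' := ratAlg_ext fun x t => (hasDerivAt_const t (1 : ℝ)).deriv
  leibniz' f g := ratAlg_ext fun x t => by
    refine ((hasDerivAt_pdt hG f x t).fun_mul (hasDerivAt_pdt hG g x t)).deriv.trans ?_
    simp
    ring

theorem coe_dx (hG : ∀ x t, val G x t ≠ 0) (f : ratAlg G) : (dx hG f : ℝ → ℝ → ℝ) = pdx f := rfl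

theorem dx_poly (hG : ∀ x t, val G x t ≠ 0) (P : MvPolynomial (Fin 2) ℝ) :
    dx hG (poly G P) = poly G (pderiv 0 P) :=
  ratAlg_ext fun x t => (hasDerivAt_val_fst P x t).deriv

theorem dt_poly (hG : ∀ x t, val G x t ≠ 0) (P : MvPolynomial (Fin 2) ℝ) :
    dt hG (poly G P) = poly G (pderiv 1 P) :=
  ratAlg_ext fun x t => (hasDerivAt_val_snd P x t).deriv

theorem pderiv_one_pderiv_zero (P : MvPolynomial (Fin 2) ℝ) :
    pderiv 1 (pderiv 0 P) = pderiv 0 (pderiv 1 P) := by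
  have hc : ⁅(pderiv 1 : Derivation ℝ (MvPolynomial (Fin 2) ℝ) (MvPolynomial (Fin 2) ℝ)),
      (pderiv 0 : Derivation ℝ (MvPolynomial (Fin 2) ℝ) (MvPolynomial (Fin 2) ℝ))⁆ = 0 :=
    MvPolynomial.derivation_ext fun i => by
      fin_cases i <;> simp [Derivation.commutator_apply, pderiv_X]
  have := congrArg (fun D => D P) hc
  simpa [Derivation.commutator_apply, sub_eq_zero] using this

/-- The commutator is a derivation that kills polynomials; applied to `f * G ^ m = P` it gives zero
times `G ^ m`, and `G` has no zeros. -/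
theorem dt_dx (hG : ∀ x t, val G x t ≠ 0) (f : ratAlg G) : dt hG (dx hG f) = dx hG (dt hG f) := by
  have key : ⁅dt hG, dx hG⁆ f = 0 := by
    obtain ⟨P, m, h⟩ := exists_mul_pow_eq_poly f
    have hpoly : ∀ Q, ⁅dt hG, dx hG⁆ (poly G Q) = 0 := fun Q => by
      rw [Derivation.commutator_apply, dx_poly, dt_poly, dt_poly, dx_poly, ← map_sub]
      rw [pderiv_one_pderiv_zero, sub_self, map_zero]
    have h1 := congrArg (fun g => ⁅dt hG, dx hG⁆ g) h
    rw [hpoly, Derivation.leibniz, ← map_pow, hpoly, smul_zero, zero_add, smul_eq_mul,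
      mul_comm] at h1
    exact eq_zero_of_mul_poly (G ^ m) (fun x t => by
      rw [val_pow]; exact pow_ne_zero _ (hG x t)) h1
  rwa [Derivation.commutator_apply, sub_eq_zero] at key

/-- `f = P / G ^ m` where `deg P ≤ m * D - k`; when `G` has degree `D` and `|G|` is bounded below
by the `D`-th power of the distance, this means that `f` decays at the rate `k`. -/
def HasDecay (D : ℤ) (k : ℤ) (f : ratAlg G) : Prop :=
  ∃ (P : MvPolynomial (Fin 2) ℝ) (m : ℕ), DegLE P (m * D - k) ∧ f * poly G G ^ m = poly G P

namespace HasDecay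

variable {D k l : ℤ} {f g : ratAlg G}

theorem of_poly (D : ℤ) {P : MvPolynomial (Fin 2) ℝ} (h : DegLE P k) :
    HasDecay D (-k) (poly G P) := ⟨P, 0, by simpa using h, by simp⟩

theorem of_frac {P : MvPolynomial (Fin 2) ℝ} (h : DegLE P (D - k))
    (hf : f * poly G G = poly G P) : HasDecay D k f := ⟨P, 1, by simpa using h, by simpa using hf⟩

theorem mono (h : HasDecay D k f) (hl : l ≤ k) : HasDecay D l f := by
  obtain ⟨P, m, hP, hf⟩ := h
  exact ⟨P, m, hP.mono (by linarith), hf⟩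

theorem mul (hf : HasDecay D k f) (hg : HasDecay D l g) : HasDecay D (k + l) (f * g) := by
  obtain ⟨P, m, hP, hf⟩ := hf
  obtain ⟨Q, r, hQ, hg⟩ := hg
  refine ⟨P * Q, m + r, (hP.mul hQ).mono (by push_cast; linarith), ?_⟩
  rw [map_mul, ← hf, ← hg]
  ring

theorem add (hD : DegLE G D) (hf : HasDecay D k f) (hg : HasDecay D k g) :
    HasDecay D k (f + g) := by
  obtain ⟨P, m, hP, hf⟩ := hf
  obtain ⟨Q, r, hQ, hg⟩ := hg
  refine ⟨P * G ^ r + Q * G ^ m, m + r, ((hP.mul (hD.pow r)).mono ?_).add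
    ((hQ.mul (hD.pow m)).mono ?_), ?_⟩
  · push_cast; linarith
  · push_cast; linarith
  · simp only [map_add, map_mul, map_pow, ← hf, ← hg]
    ring

theorem smul (c : ℝ) (hf : HasDecay D k f) : HasDecay D k (c • f) := by
  obtain ⟨P, m, hP, hf⟩ := hf
  refine ⟨C c * P, m, hP.C_mul c, ?_⟩
  rw [C_mul', map_smul, ← hf, smul_mul_assoc]

theorem sub (hD : DegLE G D) (hf : HasDecay D k f) (hg : HasDecay D k g) :
    HasDecay D k (f - g) := by
  have := hf.add hD (hg.smul (-1))
  rwa [neg_one_smul, ← sub_eq_add_neg] at this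

end HasDecay

/-- Quotient rule: the denominator gains one factor `G`, while the numerator's degree grows by only
`D - 1`. No lower bound on `|G|` is needed for this bookkeeping. -/
theorem hasDecay_derivation {D k : ℤ} {f : ratAlg G} (d : Derivation ℝ (ratAlg G) (ratAlg G))
    (i : Fin 2) (hd : ∀ P, d (poly G P) = poly G (pderiv i P)) (hD : DegLE G D)
    (hf : HasDecay D k f) : HasDecay D (k + 1) (d f) := by
  obtain ⟨P, m, hP, hf⟩ := hf
  refine ⟨pderiv i P * G - C (m : ℝ) * (P * pderiv i G), m + 1,
    (((hP.pderiv i).mul hD).mono ?_).sub (((hP.mul (hD.pderiv i)).C_mul _).mono ?_), ?_⟩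
  · push_cast; linarith
  · push_cast; linarith
  · have h1 := congrArg d hf
    rw [hd, Derivation.leibniz, Derivation.leibniz_pow, hd] at h1
    simp only [map_sub, map_mul, ← h1, ← hf]
    rcases m with _ | m
    · simp
    · simp only [smul_eq_mul, nsmul_eq_mul, Nat.add_sub_cancel]
      have : poly G (C ((m + 1 : ℕ) : ℝ)) = ((m + 1 : ℕ) : ratAlg G) := by simp
      rw [this]
      ring

theorem HasDecay.dx {D k : ℤ} {f : ratAlg G} (hG : ∀ x t, val G x t ≠ 0) (hD : DegLE G D)
    (hf : HasDecay D k f) : HasDecay D (k + 1) (dx hG f) :=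
  hasDecay_derivation _ 0 (dx_poly hG) hD hf

theorem HasDecay.dt {D k : ℤ} {f : ratAlg G} (hG : ∀ x t, val G x t ≠ 0) (hD : DegLE G D)
    (hf : HasDecay D k f) : HasDecay D (k + 1) (dt hG f) :=
  hasDecay_derivation _ 1 (dt_poly hG) hD hf

end Boussinesq

namespace Boussinesq

/-! ### The form of top degree -/

section OneVariable

open Polynomial

/-- A common factor `d` scales the Wronskian by `d ^ 2`, so one may pass to coprime polynomials,
whose Wronskian vanishes only if both are constant. -/
theorem exists_eq_C_mul_of_wronskian_eq_zero {g p : ℝ[X]} (hp : p ≠ 0)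
    (h : wronskian g p = 0) : ∃ k, g = C k * p := by
  obtain ⟨p', g', d, hrel, hp', hg'⟩ := UniqueFactorizationMonoid.exists_reduced_factors p hp g
  have hd : d ≠ 0 := by
    rintro rfl
    exact hp (by rw [← hp', zero_mul])
  have hw : wronskian g' p' = 0 := by
    have h1 : d ^ 2 * wronskian g' p' = 0 := by
      rw [← h, ← hp', ← hg']
      simp only [wronskian, derivative_mul]
      ring
    simpa [hd] using h1
  obtain ⟨hgc, hpc⟩ := hrel.isCoprime.symm.wronskian_eq_zero_iff.1 hw
  have hgc := eq_C_of_derivative_eq_zero hgc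
  have hpc := eq_C_of_derivative_eq_zero hpc
  have hp0 : p'.coeff 0 ≠ 0 := fun h0 => hp (by rw [← hp', hpc, h0, C_0, mul_zero])
  refine ⟨g'.coeff 0 / p'.coeff 0, ?_⟩
  have h2 : C (g'.coeff 0 / p'.coeff 0) * C (p'.coeff 0) = C (g'.coeff 0) := by
    rw [← C_mul, div_mul_cancel₀ _ hp0]
  rw [← hp', ← hg', hgc, hpc, coeff_C_zero, coeff_C_zero, ← h2]
  ring

/-- Descent on the degree: unless `a = k = 0`, the factor `1 + X ^ 2` divides `p`, and the quotient
solves the same equation with `a - 2` in place of `a`. Since `k` never changes, the descent can only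
end with `k = 0` and `a` an even natural number. -/
theorem eq_C_mul_pow_of_derivative {p : ℝ[X]} (hp : p ≠ 0) {a k : ℝ}
    (h : (1 + X ^ 2) * derivative p = (C a * X + C k) * p) :
    ∃ (m : ℕ) (c : ℝ), a = 2 * m ∧ p = C c * (1 + X ^ 2) ^ m := by
  induction hd : p.natDegree using Nat.strong_induction_on generalizing p a k with
  | _ d ih =>
  by_cases hak : a ^ 2 + k ^ 2 = 0
  · obtain ⟨rfl, rfl⟩ : a = 0 ∧ k = 0 := by constructor <;> nlinarith [sq_nonneg a, sq_nonneg k]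
    have h1 : (1 + X ^ 2 : ℝ[X]) ≠ 0 := by
      intro h0
      simpa using congrArg (eval 0) h0
    have h2 : derivative p = 0 := by simpa [h1] using h
    exact ⟨0, p.coeff 0, by simp, by
      simpa using eq_C_of_derivative_eq_zero h2⟩
  · obtain ⟨r, rfl⟩ : (1 + X ^ 2 : ℝ[X]) ∣ p := by
      -- Multiply the equation by `aX - k` and use `(aX - k)(aX + k) = a²(1 + X²) - (a² + k²)`.
      have h3 : C (a ^ 2 + k ^ 2) * p =
          (1 + X ^ 2) * (C (a ^ 2) * p - (C a * X - C k) * derivative p) := by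
        simp only [C_add, C_pow]
        linear_combination (C a * X - C k) * h
      have h4 : p = (1 + X ^ 2) * (C (a ^ 2 + k ^ 2)⁻¹ *
          (C (a ^ 2) * p - (C a * X - C k) * derivative p)) := by
        rw [mul_left_comm, ← h3, ← mul_assoc, ← C_mul, inv_mul_cancel₀ hak, C_1, one_mul]
      exact ⟨_, h4⟩
    have hr : r ≠ 0 := right_ne_zero_of_mul hp
    have hq : (1 + X ^ 2 : ℝ[X]) ≠ 0 := left_ne_zero_of_mul hp
    have hdeg : (1 + X ^ 2 : ℝ[X]).natDegree = 2 := by compute_degree!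
    have h5 : (1 + X ^ 2) * derivative r = (C (a - 2) * X + C k) * r := by
      refine mul_left_cancel₀ hq ?_
      simp only [derivative_mul, derivative_add, derivative_one, derivative_X_pow] at h
      simp only [C_sub]
      norm_num at h
      linear_combination h
    obtain ⟨m, c, ha, hm⟩ := ih r.natDegree (by
      rw [← hd, natDegree_mul hq hr, hdeg]; omega) hr h5 rfl
    exact ⟨m + 1, c, by push_cast; linarith, by rw [hm]; ring⟩

end OneVariable

open MvPolynomial

/-- The polynomial `F F_xx - F_x² + F F_tt - F_t²`, the numerator of the Laplacian of `ln F`. -/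
noncomputable def logLaplace (F : MvPolynomial (Fin 2) ℝ) : MvPolynomial (Fin 2) ℝ :=
  F * pderiv 0 (pderiv 0 F) - pderiv 0 F * pderiv 0 F +
    (F * pderiv 1 (pderiv 1 F) - pderiv 1 F * pderiv 1 F)

/-- The polynomial `P(s, 1)`. -/
noncomputable def dehom : MvPolynomial (Fin 2) ℝ →ₐ[ℝ] Polynomial ℝ := aeval ![Polynomial.X, 1]

theorem derivative_dehom (P : MvPolynomial (Fin 2) ℝ) :
    Polynomial.derivative (dehom P) = dehom (pderiv 0 P) := by
  induction P using MvPolynomial.induction_on with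
  | C a => simp [dehom]
  | add p q hp hq => simp [hp, hq]
  | mul_X p i hp =>
    fin_cases i
    · simp [dehom, Derivation.leibniz] at hp ⊢
      rw [hp]
      ring
    · simp [dehom, Derivation.leibniz, pderiv_X] at hp ⊢
      rw [hp]

theorem eval_dehom (P : MvPolynomial (Fin 2) ℝ) (s : ℝ) : (dehom P).eval s = val P s 1 := by
  induction P using MvPolynomial.induction_on with
  | C a => simp [dehom, val]
  | add p q hp hq => simp [hp, hq, val_add]
  | mul_X p i hp =>
    rw [map_mul, Polynomial.eval_mul, hp, val_mul]
    fin_cases i <;> simp [dehom, val]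

theorem degree_eq_of_isHomogeneous {H : MvPolynomial (Fin 2) ℝ} {N : ℕ}
    (hH : H.IsHomogeneous N) {s : Fin 2 →₀ ℕ} (hs : s ∈ H.support) : s.degree = N := by
  by_contra h
  exact mem_support_iff.1 hs (hH.coeff_eq_zero h)

theorem val_smul_of_isHomogeneous {H : MvPolynomial (Fin 2) ℝ} {N : ℕ} (hH : H.IsHomogeneous N)
    (c x t : ℝ) : val H (c * x) (c * t) = c ^ N * val H x t := by
  unfold val
  rw [eval_eq', eval_eq', Finset.mul_sum]
  refine Finset.sum_congr rfl fun s hs => ?_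
  have h1 : s.degree = N := degree_eq_of_isHomogeneous hH hs
  have h2 : s 0 + s 1 = N := by rw [← h1, Finsupp.degree_eq_sum, Fin.sum_univ_two]
  simp only [Fin.prod_univ_two, Matrix.cons_val_zero, Matrix.cons_val_one, ← h2]
  ring

theorem eq_of_dehom_eq {P Q : MvPolynomial (Fin 2) ℝ} {N : ℕ} (hP : P.IsHomogeneous N)
    (hQ : Q.IsHomogeneous N) (h : dehom P = dehom Q) : P = Q := by
  -- The factor `X 1` disposes of the line `t = 0`, which dehomogenization does not see.
  have h1 : X 1 * P = X 1 * Q := eq_of_val_eq fun x t => by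
    rw [val_mul, val_mul, val_X_one]
    rcases eq_or_ne t 0 with rfl | ht
    · simp
    · have h2 : ∀ s, val P s 1 = val Q s 1 := fun s => by rw [← eval_dehom, h, eval_dehom]
      have h3 := val_smul_of_isHomogeneous hP t (x / t) 1
      have h4 := val_smul_of_isHomogeneous hQ t (x / t) 1
      rw [mul_div_cancel₀ _ ht, mul_one] at h3 h4
      rw [h3, h4, h2]
  exact mul_left_cancel₀ (X_ne_zero 1) h1

/-- Euler's relation and its `t`-derivative eliminate `H_t` and `H_tt` on the line `t = 1`. For
`p(s) = H(s,1)`, harmonicity of `ln H` becomes `((1+s²)p'/p - Ns)' = 0`, a first-order equation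
after one integration. -/
theorem logLaplace_eq_zero_of_isHomogeneous {H : MvPolynomial (Fin 2) ℝ} {N : ℕ}
    (hH : H.IsHomogeneous N) (h0 : H ≠ 0) (h : logLaplace H = 0) :
    ∃ (m : ℕ) (c : ℝ), N = 2 * m ∧ c ≠ 0 ∧ H = C c * (X 0 ^ 2 + X 1 ^ 2) ^ m := by
  have euler : X 0 * pderiv 0 H + X 1 * pderiv 1 H = C (N : ℝ) * H := by
    have := hH.sum_X_mul_pderiv
    rw [Fin.sum_univ_two] at this
    rw [this]
    simp
  have euler1 := congrArg (pderiv 1) euler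
  have e0 := congrArg dehom euler
  have e1 := congrArg dehom euler1
  have e2 := congrArg dehom h
  have hX0 : dehom (X 0) = Polynomial.X := by simp [dehom]
  have hX1 : dehom (X 1) = 1 := by simp [dehom]
  have hC : dehom (C (N : ℝ)) = Polynomial.C (N : ℝ) := by simp [dehom]
  have hd1 : pderiv (R := ℝ) (1 : Fin 2) (X 0) = 0 := by simp [pderiv_X]
  simp only [Derivation.leibniz, map_add, smul_eq_mul, hd1, pderiv_X_self, pderiv_C,
    pderiv_one_pderiv_zero, mul_zero, add_zero, mul_one, map_mul, hX0, hX1, hC] at e0 e1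
  simp only [logLaplace, map_add, map_sub, map_mul, map_zero, ← derivative_dehom] at e0 e1 e2
  set p := dehom H with hp
  set r := dehom (pderiv 1 H) with hr
  have hp0 : p ≠ 0 := fun hp0 => h0 (eq_of_dehom_eq hH (isHomogeneous_zero _ _ N)
    (by rw [← hp, hp0, map_zero]))
  have hr' : r = Polynomial.C (N : ℝ) * p - Polynomial.X * Polynomial.derivative p := by
    linear_combination e0
  rw [hr'] at e1 e2
  -- The vanishing derivative of `((1+s²)p' - Nsp)/p`, cleared of denominators.
  have hw : Polynomial.wronskian ((1 + Polynomial.X ^ 2) * Polynomial.derivative p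
      - Polynomial.C (N : ℝ) * Polynomial.X * p) p = 0 := by
    simp only [Polynomial.wronskian]
    simp at e1 e2 ⊢
    linear_combination -e2 + p * e1
  obtain ⟨k, hk⟩ := exists_eq_C_mul_of_wronskian_eq_zero hp0 hw
  obtain ⟨m, c, hm, hpm⟩ := eq_C_mul_pow_of_derivative hp0 (a := N) (k := k)
    (by linear_combination hk)
  have hN : N = 2 * m := by exact_mod_cast hm
  refine ⟨m, c, hN, ?_, ?_⟩
  · rintro rfl
    exact hp0 (by simp [hpm])
  · refine eq_of_dehom_eq hH ?_ ?_
    · have h1 := ((isHomogeneous_X ℝ (0 : Fin 2)).pow 2).add ((isHomogeneous_X ℝ (1 : Fin 2)).pow 2)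
      have h2 := (isHomogeneous_C (Fin 2) c).mul (h1.pow m)
      convert h2 using 1
      omega
    · rw [← hp, hpm]
      simp [dehom, add_comm]

theorem homogeneousComponent_totalDegree_ne_zero {F : MvPolynomial (Fin 2) ℝ} (h : F ≠ 0) :
    homogeneousComponent F.totalDegree F ≠ 0 := by
  obtain ⟨s, hs, hsd⟩ := Finset.exists_mem_eq_sup F.support (by simpa using h)
    (fun s => s.sum fun _ e => e)
  intro h0
  have h1 := congrArg (coeff s) h0
  rw [coeff_homogeneousComponent, if_pos, coeff_zero] at h1
  · exact mem_support_iff.1 hs h1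
  · exact hsd.symm

theorem degLE_sub_homogeneousComponent (F : MvPolynomial (Fin 2) ℝ) :
    DegLE (F - homogeneousComponent F.totalDegree F) (F.totalDegree - 1) := fun s hs => by
  rw [mem_support_iff, coeff_sub, coeff_homogeneousComponent] at hs
  split_ifs at hs with h
  · simp at hs
  · have h1 : s.degree ≤ F.totalDegree := le_totalDegree (mem_support_iff.2 (by simpa using hs))
    omega

theorem logLaplace_add (H R : MvPolynomial (Fin 2) ℝ) : logLaplace (H + R) = logLaplace H +
    (H * pderiv 0 (pderiv 0 R) + R * pderiv 0 (pderiv 0 H) + R * pderiv 0 (pderiv 0 R)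
      - (pderiv 0 H * pderiv 0 R + pderiv 0 H * pderiv 0 R + pderiv 0 R * pderiv 0 R)
    + (H * pderiv 1 (pderiv 1 R) + R * pderiv 1 (pderiv 1 H) + R * pderiv 1 (pderiv 1 R)
      - (pderiv 1 H * pderiv 1 R + pderiv 1 H * pderiv 1 R + pderiv 1 R * pderiv 1 R))) := by
  simp only [logLaplace, map_add]
  ring

theorem DegLE.mul_of_le {P Q : MvPolynomial (Fin 2) ℝ} {d e f : ℤ} (hP : DegLE P d) (hQ : DegLE Q e)
    (h : d + e ≤ f) : DegLE (P * Q) f := (hP.mul hQ).mono h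

theorem IsHomogeneous.degLE {H : MvPolynomial (Fin 2) ℝ} {N : ℕ} (hH : H.IsHomogeneous N) :
    DegLE H N := fun s hs => by
  rw [degree_eq_of_isHomogeneous hH hs]

/-- The expression for the top form is homogeneous of degree `2N - 2`, whereas every term involving
the remainder has degree at most `2N - 3`; a drop in the total degree below `2N - 2` therefore kills
it. -/
theorem logLaplace_homogeneousComponent {F : MvPolynomial (Fin 2) ℝ} (hN : 2 ≤ F.totalDegree)
    (h : DegLE (logLaplace F) (2 * F.totalDegree - 4)) :
    logLaplace (homogeneousComponent F.totalDegree F) = 0 := by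
  set N := F.totalDegree with hNdef
  set H := homogeneousComponent N F with hHdef
  have hH : H.IsHomogeneous N := homogeneousComponent_isHomogeneous N F
  have hR := degLE_sub_homogeneousComponent F
  rw [← hNdef, ← hHdef] at hR
  have hHd := IsHomogeneous.degLE hH
  have h1 : DegLE (logLaplace H) (2 * N - 3) := by
    have h2 := logLaplace_add H (F - H)
    rw [add_sub_cancel] at h2
    rw [← sub_eq_iff_eq_add] at h2
    rw [← h2]
    have hR' := fun i => hR.pderiv i
    have hR'' := fun i => (hR' i).pderiv i
    have hH' := fun i => hHd.pderiv i
    have hH'' := fun i => (hH' i).pderiv i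
    refine (h.mono (by linarith)).sub ?_
    refine DegLE.add (DegLE.sub (DegLE.add (DegLE.add ?_ ?_) ?_) (DegLE.add (DegLE.add ?_ ?_) ?_))
      (DegLE.sub (DegLE.add (DegLE.add ?_ ?_) ?_) (DegLE.add (DegLE.add ?_ ?_) ?_))
    · exact hHd.mul_of_le (hR'' 0) (by linarith)
    · exact hR.mul_of_le (hH'' 0) (by linarith)
    · exact hR.mul_of_le (hR'' 0) (by linarith)
    · exact (hH' 0).mul_of_le (hR' 0) (by linarith)
    · exact (hH' 0).mul_of_le (hR' 0) (by linarith)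
    · exact (hR' 0).mul_of_le (hR' 0) (by linarith)
    · exact hHd.mul_of_le (hR'' 1) (by linarith)
    · exact hR.mul_of_le (hH'' 1) (by linarith)
    · exact hR.mul_of_le (hR'' 1) (by linarith)
    · exact (hH' 1).mul_of_le (hR' 1) (by linarith)
    · exact (hH' 1).mul_of_le (hR' 1) (by linarith)
    · exact (hR' 1).mul_of_le (hR' 1) (by linarith)
  have h2 : (logLaplace H).IsHomogeneous (N + (N - 1 - 1)) := by
    have h3 : N - 1 + (N - 1) = N + (N - 1 - 1) := by omega
    have key : ∀ i : Fin 2, (H * pderiv i (pderiv i H) - pderiv i H * pderiv i H).IsHomogeneous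
        (N + (N - 1 - 1)) := fun i =>
      (hH.mul hH.pderiv.pderiv).sub (h3 ▸ (hH.pderiv (i := i)).mul (hH.pderiv (i := i)))
    exact (key 0).add (key 1)
  by_contra h0
  obtain ⟨s, hs⟩ := Finset.nonempty_iff_ne_empty.2 (mt MvPolynomial.support_eq_empty.1 h0)
  have h4 := degree_eq_of_isHomogeneous h2 hs
  have h5 := h1 s hs
  omega

end Boussinesq

namespace Boussinesq

open MvPolynomial Filter Topology

/-! ### Growth and decay -/

/-- The Japanese bracket `√(1 + x² + t²)`. -/
noncomputable def bracket (x t : ℝ) : ℝ := √(1 + x ^ 2 + t ^ 2)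

theorem bracket_sq (x t : ℝ) : bracket x t ^ 2 = 1 + x ^ 2 + t ^ 2 :=
  Real.sq_sqrt (by positivity)

theorem one_le_bracket (x t : ℝ) : 1 ≤ bracket x t :=
  Real.one_le_sqrt.2 (by nlinarith [sq_nonneg x, sq_nonneg t])

theorem bracket_pos (x t : ℝ) : 0 < bracket x t := one_pos.trans_le (one_le_bracket x t)

theorem abs_fst_le_bracket (x t : ℝ) : |x| ≤ bracket x t :=
  Real.abs_le_sqrt (by nlinarith [sq_nonneg t])

theorem abs_snd_le_bracket (x t : ℝ) : |t| ≤ bracket x t :=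
  Real.abs_le_sqrt (by nlinarith [sq_nonneg x])

theorem one_add_norm_le_bracket (p : ℝ × ℝ) : 1 + ‖p‖ ≤ 2 * bracket p.1 p.2 := by
  have h : ‖p‖ ≤ bracket p.1 p.2 := by
    rw [Prod.norm_def]
    exact max_le (abs_fst_le_bracket _ _) (abs_snd_le_bracket _ _)
  linarith [one_le_bracket p.1 p.2]

theorem DegLE.abs_val_le {P : MvPolynomial (Fin 2) ℝ} {d : ℤ} (hP : DegLE P d) :
    ∃ K, 0 ≤ K ∧ ∀ x t, |val P x t| ≤ K * bracket x t ^ d := by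
  refine ⟨∑ s ∈ P.support, |coeff s P|, Finset.sum_nonneg fun _ _ => abs_nonneg _, fun x t => ?_⟩
  unfold val
  rw [eval_eq', Finset.sum_mul]
  refine (Finset.abs_sum_le_sum_abs _ _).trans (Finset.sum_le_sum fun s hs => ?_)
  rw [abs_mul]
  refine mul_le_mul_of_nonneg_left ?_ (abs_nonneg _)
  have h1 : s.degree = s 0 + s 1 := by rw [Finsupp.degree_eq_sum, Fin.sum_univ_two]
  simp only [Fin.prod_univ_two, Matrix.cons_val_zero, Matrix.cons_val_one, abs_mul, abs_pow]
  calc |x| ^ s 0 * |t| ^ s 1 ≤ bracket x t ^ s 0 * bracket x t ^ s 1 := by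
        have := bracket_pos x t
        gcongr
        exacts [abs_fst_le_bracket x t, abs_snd_le_bracket x t]
    _ = bracket x t ^ (s.degree : ℤ) := by rw [zpow_natCast, h1, pow_add]
    _ ≤ bracket x t ^ d := zpow_le_zpow_right₀ (one_le_bracket x t) (hP s hs)

/-- The polynomial `1 + x² + t²`. -/
noncomputable def bracketSq : MvPolynomial (Fin 2) ℝ := 1 + X 0 ^ 2 + X 1 ^ 2

theorem val_bracketSq (x t : ℝ) : val bracketSq x t = 1 + x ^ 2 + t ^ 2 := by
  simp [bracketSq, val]

theorem degLE_X_sq_add (d : ℤ) (hd : 2 ≤ d) :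
    DegLE (X 0 ^ 2 + X 1 ^ 2 : MvPolynomial (Fin 2) ℝ) d :=
  ((((degLE_X 0).pow 2).mono (by simpa)).add (((degLE_X 1).pow 2).mono (by simpa)))

theorem degLE_bracketSq : DegLE bracketSq 2 := by
  have h : bracketSq = C 1 + (X 0 ^ 2 + X 1 ^ 2) := by rw [bracketSq, C_1]; ring
  rw [h]
  exact ((degLE_C 1).mono (by norm_num)).add (degLE_X_sq_add 2 le_rfl)

theorem degLE_bracketSq_pow_sub (m : ℕ) :
    DegLE (bracketSq ^ m - (X 0 ^ 2 + X 1 ^ 2) ^ m) (2 * m - 2) := by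
  induction m with
  | zero => simpa using degLE_zero _
  | succ m ih =>
    have h : bracketSq ^ (m + 1) - (X 0 ^ 2 + X 1 ^ 2) ^ (m + 1) =
        bracketSq * (bracketSq ^ m - (X 0 ^ 2 + X 1 ^ 2) ^ m) + (X 0 ^ 2 + X 1 ^ 2) ^ m := by
      simp only [bracketSq]
      ring
    rw [h]
    refine (degLE_bracketSq.mul_of_le ih ?_).add (((degLE_X_sq_add 2 le_rfl).pow m).mono ?_)
    · push_cast; linarith
    · push_cast; linarith

/-- Far out the definite top form dominates; on the remaining compact set `|F|` has a positive
minimum. -/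
theorem exists_bracket_pow_le {F : MvPolynomial (Fin 2) ℝ} (h0 : ∀ x t, val F x t ≠ 0) {m : ℕ}
    {c : ℝ} (hc : c ≠ 0)
    (hF : DegLE (F - C c * (X 0 ^ 2 + X 1 ^ 2) ^ m) (2 * m - 1)) :
    ∃ ε, 0 < ε ∧ ∀ x t, ε * bracket x t ^ (2 * m) ≤ |val F x t| := by
  have h1 : DegLE (F - C c * bracketSq ^ m) (2 * m - 1) := by
    have : F - C c * bracketSq ^ m = (F - C c * (X 0 ^ 2 + X 1 ^ 2) ^ m) -
        C c * (bracketSq ^ m - (X 0 ^ 2 + X 1 ^ 2) ^ m) := by ring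
    rw [this]
    exact hF.sub (((degLE_bracketSq_pow_sub m).C_mul c).mono (by linarith))
  obtain ⟨K, hK, hb⟩ := h1.abs_val_le
  have hc' : 0 < |c| := abs_pos.2 hc
  -- Beyond this radius the lower-order part is at most half the leading term; the `+ 1` makes `M`
  -- positive even when `K = 0`.
  set M := 2 * K / |c| + 1 with hM
  have hM0 : 1 ≤ M := by
    have : 0 ≤ 2 * K / |c| := by positivity
    linarith
  obtain ⟨p, -, hp⟩ := (isCompact_closedBall (0 : ℝ × ℝ) M).exists_isMinOn
    ⟨0, by simp; linarith⟩ (continuous_val F).abs.continuousOn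
  set δ := |val F p.1 p.2| with hδ
  have hδ0 : 0 < δ := abs_pos.2 (h0 _ _)
  refine ⟨min (|c| / 2) (δ / M ^ (2 * m)), by positivity, fun x t => ?_⟩
  have hJ := bracket_pos x t
  rcases le_total (bracket x t) M with hle | hle
  · have h2 : δ ≤ |val F x t| := hp (a := (x, t)) (by
      rw [mem_closedBall_zero_iff, Prod.norm_def]
      exact max_le ((abs_fst_le_bracket x t).trans hle) ((abs_snd_le_bracket x t).trans hle))
    calc min (|c| / 2) (δ / M ^ (2 * m)) * bracket x t ^ (2 * m)
        ≤ δ / M ^ (2 * m) * M ^ (2 * m) := by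
          gcongr
          exact min_le_right _ _
      _ = δ := by field_simp
      _ ≤ _ := h2
  · have h2 := hb x t
    have h3 : bracket x t ^ (2 * m) = bracket x t * bracket x t ^ (2 * m - 1 : ℤ) := by
      rw [← zpow_one_add₀ hJ.ne', ← zpow_natCast]
      congr 1
      push_cast
      ring
    have h4 : 2 * K ≤ |c| * bracket x t := by
      have : 2 * K / |c| ≤ bracket x t := by linarith
      rw [div_le_iff₀ hc'] at this
      linarith
    have h5 : val (F - C c * bracketSq ^ m) x t = val F x t - c * bracket x t ^ (2 * m) := by
      rw [val_sub, val_mul, val_pow, val_C, val_bracketSq, pow_mul, bracket_sq]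
    have h6 : |c| * bracket x t ^ (2 * m) ≤ |val F x t| + K * bracket x t ^ (2 * m - 1 : ℤ) := by
      have h7 := abs_sub_abs_le_abs_sub (c * bracket x t ^ (2 * m)) (val F x t)
      rw [abs_sub_comm, ← h5, abs_mul, abs_of_pos (pow_pos hJ _)] at h7
      linarith
    have h8 : K * bracket x t ^ (2 * m - 1 : ℤ) ≤ |c| / 2 * bracket x t ^ (2 * m) := by
      rw [h3, ← mul_assoc]
      refine mul_le_mul_of_nonneg_right ?_ (zpow_pos hJ _).le
      linarith
    calc min (|c| / 2) (δ / M ^ (2 * m)) * bracket x t ^ (2 * m)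
        ≤ |c| / 2 * bracket x t ^ (2 * m) := by
          gcongr
          exact min_le_left _ _
      _ ≤ _ := by linarith

variable {G : MvPolynomial (Fin 2) ℝ} {D : ℕ} {k : ℤ} {f : ratAlg G} {ε : ℝ}

/-- Here the algebraic order becomes genuine decay, by virtue of the lower bound on `|G|`. -/
theorem HasDecay.abs_le (hε : 0 < ε) (hG : ∀ x t, ε * bracket x t ^ D ≤ |val G x t|)
    (hf : HasDecay D k f) : ∃ K, 0 ≤ K ∧
      ∀ x t, |(f : ℝ → ℝ → ℝ) x t| ≤ K * bracket x t ^ (-k) := by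
  obtain ⟨P, m, hP, h⟩ := hf
  obtain ⟨K, hK, hb⟩ := hP.abs_val_le
  refine ⟨K / ε ^ m, by positivity, fun x t => ?_⟩
  have hJ := bracket_pos x t
  have h1 : (f : ℝ → ℝ → ℝ) x t * val G x t ^ m = val P x t :=
    congrFun (congrFun (congrArg Subtype.val h) x) t
  have h2 : |(f : ℝ → ℝ → ℝ) x t| * |val G x t| ^ m ≤ K * bracket x t ^ (m * D - k : ℤ) := by
    rw [← abs_pow, ← abs_mul, h1]
    exact hb x t
  have h3 : |(f : ℝ → ℝ → ℝ) x t| * (ε * bracket x t ^ D) ^ m ≤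
      K * bracket x t ^ (m * D - k : ℤ) := by
    refine le_trans ?_ h2
    gcongr
    exact hG x t
  have h4 : bracket x t ^ (m * D - k : ℤ) = (bracket x t ^ D) ^ m * bracket x t ^ (-k) := by
    rw [← pow_mul, ← zpow_natCast, ← zpow_add₀ hJ.ne']
    congr 1
    push_cast
    ring
  rw [h4, mul_pow] at h3
  rw [div_mul_eq_mul_div, le_div_iff₀ (by positivity)]
  refine le_of_mul_le_mul_right ?_ (pow_pos (pow_pos hJ D) m)
  linarith

theorem continuous_ratAlg (hG : ∀ x t, val G x t ≠ 0) (f : ratAlg G) :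
    Continuous fun p : ℝ × ℝ => (f : ℝ → ℝ → ℝ) p.1 p.2 := by
  obtain ⟨P, m, h⟩ := f.2
  have h1 : (fun p : ℝ × ℝ => (f : ℝ → ℝ → ℝ) p.1 p.2) =
      fun p => val P p.1 p.2 / val G p.1 p.2 ^ m := funext fun p => by
    rw [← h, mul_div_cancel_right₀ _ (pow_ne_zero _ (hG _ _))]
  rw [h1]
  exact (continuous_val P).div ((continuous_val G).pow m) fun p => pow_ne_zero _ (hG _ _)

theorem ne_zero_of_bracket_le (hε : 0 < ε) (hG : ∀ x t, ε * bracket x t ^ D ≤ |val G x t|)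
    (x t : ℝ) : val G x t ≠ 0 :=
  abs_pos.1 ((mul_pos hε (pow_pos (bracket_pos x t) D)).trans_le (hG x t))

theorem HasDecay.integrable (hε : 0 < ε) (hG : ∀ x t, ε * bracket x t ^ D ≤ |val G x t|)
    (hf : HasDecay D 3 f) : Integrable fun p : ℝ × ℝ => (f : ℝ → ℝ → ℝ) p.1 p.2 := by
  obtain ⟨K, hK, hb⟩ := hf.abs_le hε hG
  have h1 : Integrable fun p : ℝ × ℝ => (1 + ‖p‖) ^ (-(3 : ℝ)) :=
    integrable_one_add_norm (by simp; norm_num)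
  -- The `8` is `2 ^ 3`, from `1 + ‖p‖ ≤ 2 * bracket`; exponent 3 exceeds the dimension 2.
  refine (h1.const_mul (8 * K)).mono'
    (continuous_ratAlg (ne_zero_of_bracket_le hε hG) f).aestronglyMeasurable
    (ae_of_all _ fun p => (hb p.1 p.2).trans ?_)
  have h2 : (1 + ‖p‖) ^ (-(3 : ℝ)) = ((1 + ‖p‖) ^ 3)⁻¹ := by
    rw [Real.rpow_neg (by positivity)]
    norm_cast
  have hJ := bracket_pos p.1 p.2
  have h3 : bracket p.1 p.2 ^ (-3 : ℤ) = (bracket p.1 p.2 ^ 3)⁻¹ := by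
    rw [zpow_neg]
    norm_cast
  have h4 : (1 + ‖p‖) ^ 3 ≤ (2 * bracket p.1 p.2) ^ 3 := by
    gcongr
    exact one_add_norm_le_bracket p
  rw [h2, h3, mul_comm 8 K, mul_assoc]
  refine mul_le_mul_of_nonneg_left ?_ hK
  rw [← div_eq_mul_inv, inv_eq_one_div, div_le_div_iff₀ (by positivity) (by positivity)]
  linarith

theorem tendsto_zero_of_abs_le {g : ℝ → ℝ} {K : ℝ} (hg : ∀ y, |g y| * |y| ≤ K) {l : Filter ℝ}
    (hl : Tendsto (fun y : ℝ => |y|) l atTop) : Tendsto g l (𝓝 0) := by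
  refine squeeze_zero_norm' ?_ (hl.const_div_atTop K)
  filter_upwards [hl.eventually_gt_atTop 0] with y hy
  rw [le_div_iff₀ hy]
  exact hg y

theorem HasDecay.exists_abs_mul_le (hε : 0 < ε) (hG : ∀ x t, ε * bracket x t ^ D ≤ |val G x t|)
    (hf : HasDecay D 1 f) : ∃ K, ∀ x t, |(f : ℝ → ℝ → ℝ) x t| * bracket x t ≤ K := by
  obtain ⟨K, hK, hb⟩ := hf.abs_le hε hG
  refine ⟨K, fun x t => ?_⟩
  have hJ := bracket_pos x t
  have := hb x t
  rwa [zpow_neg, zpow_one, ← div_eq_mul_inv, le_div_iff₀ hJ] at this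

/-- Order 2 puts the derivative at order 3, which is integrable. By Fubini it suffices to integrate
along almost every horizontal line, where `f` tends to zero at both ends. -/
theorem HasDecay.integral_dx_eq_zero (hε : 0 < ε)
    (hG : ∀ x t, ε * bracket x t ^ D ≤ |val G x t|) (hG0 : ∀ x t, val G x t ≠ 0)
    (hD : DegLE G D) (hf : HasDecay D 2 f) :
    ∫ p : ℝ × ℝ, (Boussinesq.dx hG0 f : ℝ → ℝ → ℝ) p.1 p.2 = 0 := by
  have hint := (hf.dx hG0 hD).integrable hε hG
  obtain ⟨K, hK⟩ := (hf.mono (by norm_num : (1 : ℤ) ≤ 2)).exists_abs_mul_le hε hG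
  rw [Measure.volume_eq_prod, integral_prod_symm _ (by rwa [← Measure.volume_eq_prod])]
  refine integral_eq_zero_of_ae ?_
  rw [Measure.volume_eq_prod] at hint
  filter_upwards [hint.prod_left_ae] with t ht
  have hb : ∀ y, |(f : ℝ → ℝ → ℝ) y t| * |y| ≤ K := fun y =>
    le_trans (mul_le_mul_of_nonneg_left (abs_fst_le_bracket y t) (abs_nonneg _)) (hK y t)
  have := integral_of_hasDerivAt_of_tendsto (fun x => hasDerivAt_pdx hG0 f x t) ht
    (tendsto_zero_of_abs_le hb tendsto_abs_atBot_atTop)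
    (tendsto_zero_of_abs_le hb tendsto_abs_atTop_atTop)
  exact this.trans (sub_self 0)

theorem HasDecay.integral_dt_eq_zero (hε : 0 < ε)
    (hG : ∀ x t, ε * bracket x t ^ D ≤ |val G x t|) (hG0 : ∀ x t, val G x t ≠ 0)
    (hD : DegLE G D) (hf : HasDecay D 2 f) :
    ∫ p : ℝ × ℝ, (Boussinesq.dt hG0 f : ℝ → ℝ → ℝ) p.1 p.2 = 0 := by
  have hint := (hf.dt hG0 hD).integrable hε hG
  obtain ⟨K, hK⟩ := (hf.mono (by norm_num : (1 : ℤ) ≤ 2)).exists_abs_mul_le hε hG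
  rw [Measure.volume_eq_prod, integral_prod _ (by rwa [← Measure.volume_eq_prod])]
  refine integral_eq_zero_of_ae ?_
  rw [Measure.volume_eq_prod] at hint
  filter_upwards [hint.prod_right_ae] with x hx
  have hb : ∀ s, |(f : ℝ → ℝ → ℝ) x s| * |s| ≤ K := fun s =>
    le_trans (mul_le_mul_of_nonneg_left (abs_snd_le_bracket x s) (abs_nonneg _)) (hK x s)
  have := integral_of_hasDerivAt_of_tendsto (fun t => hasDerivAt_pdt hG0 f x t) hx
    (tendsto_zero_of_abs_le hb tendsto_abs_atBot_atTop)
    (tendsto_zero_of_abs_le hb tendsto_abs_atTop_atTop)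
  exact this.trans (sub_self 0)

theorem integral_inv_one_add_sq_sq :
    ∫ p : ℝ × ℝ, ((1 + p.1 ^ 2 + p.2 ^ 2) ^ 2)⁻¹ = Real.pi := by
  rw [← integral_comp_polarCoord_symm]
  have h1 : ∀ p ∈ polarCoord.target, p.1 • ((1 + (polarCoord.symm p).1 ^ 2 +
      (polarCoord.symm p).2 ^ 2) ^ 2)⁻¹ = (p.1 * ((1 + p.1 ^ 2) ^ 2)⁻¹) * 1 := fun p _ => by
    have : 1 + (p.1 * Real.cos p.2) ^ 2 + (p.1 * Real.sin p.2) ^ 2 = 1 + p.1 ^ 2 := by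
      linear_combination p.1 ^ 2 * Real.sin_sq_add_cos_sq p.2
    simp [this]
  rw [setIntegral_congr_fun polarCoord.open_target.measurableSet h1, polarCoord_target,
    Measure.volume_eq_prod, setIntegral_prod_mul (fun r : ℝ => r * ((1 + r ^ 2) ^ 2)⁻¹)
      (fun _ : ℝ => (1 : ℝ))]
  have h2 : ∫ r in Set.Ioi (0 : ℝ), r * ((1 + r ^ 2) ^ 2)⁻¹ = 1 / 2 := by
    have hd : ∀ r ∈ Set.Ici (0 : ℝ), HasDerivAt (fun r : ℝ => -(2 * (1 + r ^ 2))⁻¹)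
        (r * ((1 + r ^ 2) ^ 2)⁻¹) r := fun r _ => by
      have h3 : HasDerivAt (fun r : ℝ => 2 * (1 + r ^ 2)) (2 * (2 * r)) r := by
        simpa using (((hasDerivAt_id' r).fun_pow 2).const_add 1).const_mul 2
      have h4 : 2 * (1 + r ^ 2) ≠ 0 := by positivity
      refine (h3.fun_inv h4).fun_neg.congr_deriv ?_
      field_simp
    have ht : Tendsto (fun r : ℝ => -(2 * (1 + r ^ 2))⁻¹) atTop (𝓝 (-0)) := by
      refine (Tendsto.inv_tendsto_atTop ?_).neg
      refine Tendsto.const_mul_atTop two_pos (tendsto_atTop_add_const_left _ _ ?_)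
      exact tendsto_pow_atTop two_ne_zero
    have := integral_Ioi_of_hasDerivAt_of_nonneg' hd (fun r hr => by
      have : (0 : ℝ) < r := hr
      positivity) ht
    rw [this]
    norm_num
  rw [h2]
  simp
  -- The length of the angular interval appears truncated at zero.
  rw [max_eq_left (by positivity)]
  ring

end Boussinesq

namespace Boussinesq

open MvPolynomial

/-! ### Restriction to horizontal lines -/

/-- The polynomial `P(·, t)`. -/
noncomputable def slice (t : ℝ) : MvPolynomial (Fin 2) ℝ →ₐ[ℝ] Polynomial ℝ :=
  aeval ![Polynomial.X, Polynomial.C t]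

theorem eval_slice (t : ℝ) (P : MvPolynomial (Fin 2) ℝ) (x : ℝ) :
    (slice t P).eval x = val P x t := by
  induction P using MvPolynomial.induction_on with
  | C a => simp [slice, val]
  | add p q hp hq => simp [hp, hq, val_add]
  | mul_X p i hp =>
    rw [map_mul, Polynomial.eval_mul, hp, val_mul]
    fin_cases i <;> simp [slice, val]

theorem coeff_slice (t : ℝ) (P : MvPolynomial (Fin 2) ℝ) (i : ℕ) :
    (slice t P).coeff i = ∑ s ∈ P.support, if s 0 = i then coeff s P * t ^ s 1 else 0 := by
  conv_lhs => rw [P.as_sum, map_sum, Polynomial.finsetSum_coeff]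
  refine Finset.sum_congr rfl fun s _ => ?_
  have h : slice t (monomial s (coeff s P)) =
      Polynomial.C (coeff s P * t ^ s 1) * Polynomial.X ^ s 0 := by
    rw [slice, aeval_monomial, Finsupp.prod_fintype _ _ (by simp), Fin.prod_univ_two]
    simp
    ring
  rw [h, Polynomial.coeff_C_mul_X_pow]
  simp only [eq_comm]

theorem DegLE.coeff_slice_eq_zero {P : MvPolynomial (Fin 2) ℝ} {d : ℤ} (hP : DegLE P d) (t : ℝ)
    {i : ℕ} (hi : d < i) : (slice t P).coeff i = 0 := by
  rw [coeff_slice]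
  refine Finset.sum_eq_zero fun s hs => if_neg fun h => ?_
  have h1 := hP s hs
  rw [Finsupp.degree_eq_sum, Fin.sum_univ_two] at h1
  push_cast at h1
  omega

theorem natDegree_slice_le_totalDegree (t : ℝ) (P : MvPolynomial (Fin 2) ℝ) :
    (slice t P).natDegree ≤ P.totalDegree :=
  Polynomial.natDegree_le_iff_coeff_eq_zero.2 fun _ hi =>
    (degLE_totalDegree P).coeff_slice_eq_zero t (by exact_mod_cast hi)

/-- Equality of the `x`-degree and the total degree means that the monomial `x ^ N` occurs. It is
the only one with `x`-exponent `N`, so the leading coefficient does not depend on `t`. -/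
theorem natDegree_slice {F : MvPolynomial (Fin 2) ℝ} {N : ℕ} (hN : 0 < N)
    (h1 : F.degreeOf 0 = N) (h2 : F.totalDegree = N) (t : ℝ) : (slice t F).natDegree = N := by
  refine le_antisymm (h2 ▸ natDegree_slice_le_totalDegree t F)
    (Polynomial.le_natDegree_of_ne_zero ?_)
  have hdeg : ∀ s ∈ F.support, s 0 + s 1 ≤ N := fun s hs => by
    have := degLE_totalDegree F s hs
    rw [Finsupp.degree_eq_sum, Fin.sum_univ_two, h2] at this
    exact_mod_cast this
  obtain ⟨r, hr, hr0⟩ : ∃ r ∈ F.support, r 0 = N := by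
    have hne : F.support.Nonempty := by
      rw [Finset.nonempty_iff_ne_empty]
      intro h0
      rw [MvPolynomial.support_eq_empty.1 h0] at h2
      simp at h2
      omega
    obtain ⟨r, hr, h⟩ := Finset.exists_mem_eq_sup F.support hne (fun s => s 0)
    exact ⟨r, hr, by rw [← h1, degreeOf_eq_sup, h]⟩
  have hr1 : r 1 = 0 := by have := hdeg r hr; omega
  rw [coeff_slice, Finset.sum_eq_single r]
  · rw [if_pos hr0, hr1, pow_zero, mul_one]
    exact mem_support_iff.1 hr
  · intro s hs hsr
    refine if_neg fun h => hsr ?_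
    have := hdeg s hs
    ext i
    fin_cases i
    · simp; omega
    · simp; omega
  · exact fun h => absurd hr h

/-- On a horizontal line `E` is a constant `g` with `g * G ^ m = P`. The coefficient of `x ^ (m *
D)` is `g` times a nonzero number on the left and zero on the right. Only exact degrees on lines
enter, so this applies before any lower bound on `|G|` is known. -/
theorem eq_zero_of_dx_eq_zero {G : MvPolynomial (Fin 2) ℝ} (hG : ∀ x t, val G x t ≠ 0) {D : ℕ}
    (hD : ∀ t, (slice t G).natDegree = D) {E : ratAlg G} {k : ℤ} (hk : 0 < k)
    (hE : HasDecay D k E) (h : dx hG E = 0) : E = 0 := by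
  obtain ⟨P, m, hP, hm⟩ := hE
  refine ratAlg_ext fun x t => ?_
  have hconst : ∀ y, (E : ℝ → ℝ → ℝ) y t = (E : ℝ → ℝ → ℝ) x t := fun y =>
    is_const_of_deriv_eq_zero (f := fun y => (E : ℝ → ℝ → ℝ) y t)
      (fun y => (hasDerivAt_pdx hG E y t).differentiableAt)
      (fun y => congrFun (congrFun (congrArg Subtype.val h) y) t) y x
  set g := (E : ℝ → ℝ → ℝ) x t with hg
  have h1 : Polynomial.C g * slice t G ^ m = slice t P := Polynomial.funext fun y => by
    have h2 : (E : ℝ → ℝ → ℝ) y t * val G y t ^ m = val P y t :=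
      congrFun (congrFun (congrArg Subtype.val hm) y) t
    rw [Polynomial.eval_mul, Polynomial.eval_pow, Polynomial.eval_C, eval_slice, eval_slice, ← h2,
      hconst]
  have h3 := congrArg (fun p => Polynomial.coeff p (m * (slice t G).natDegree)) h1
  simp only [Polynomial.coeff_C_mul, Polynomial.coeff_pow_mul_natDegree] at h3
  rw [hP.coeff_slice_eq_zero t (by rw [hD]; push_cast; linarith)] at h3
  have h4 : slice t G ≠ 0 := fun h0 => hG x t (by rw [← eval_slice, h0, Polynomial.eval_zero])
  simpa [h4] using h3

/-! ### The logarithmic derivatives of `F` -/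

theorem val_mul_bracketSq_ne_zero {F : MvPolynomial (Fin 2) ℝ} (hF : ∀ x t, val F x t ≠ 0)
    (x t : ℝ) : val (F * bracketSq) x t ≠ 0 := by
  rw [val_mul, val_bracketSq]
  exact mul_ne_zero (hF x t) (by positivity)

section

variable {F : MvPolynomial (Fin 2) ℝ} (hF : ∀ x t, val F x t ≠ 0)

/-- The function `P / F`. -/
noncomputable def overF (P : MvPolynomial (Fin 2) ℝ) : ratAlg (F * bracketSq) :=
  frac (val_mul_bracketSq_ne_zero hF) (P * bracketSq)

theorem coe_overF (P : MvPolynomial (Fin 2) ℝ) (x t : ℝ) :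
    (overF hF P : ℝ → ℝ → ℝ) x t = val P x t / val F x t := by
  have h : val bracketSq x t ≠ 0 := by rw [val_bracketSq]; positivity
  simp only [overF, frac, val_mul]
  rw [mul_div_mul_right _ _ h]

theorem overF_mul (P : MvPolynomial (Fin 2) ℝ) :
    overF hF P * poly (F * bracketSq) F = poly (F * bracketSq) P := ratAlg_ext fun x t => by
  have := hF x t
  simp [coe_overF, coe_poly, this]

theorem pdx_logVal : pdx (logVal F) = overF hF (pderiv 0 F) := by
  ext x t
  rw [coe_overF]
  exact ((hasDerivAt_val_fst F x t).log (hF x t)).deriv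

theorem pdt_logVal : pdt (logVal F) = overF hF (pderiv 1 F) := by
  ext x t
  rw [coe_overF]
  exact ((hasDerivAt_val_snd F x t).log (hF x t)).deriv

local notation "∂x" => dx (val_mul_bracketSq_ne_zero hF)
local notation "∂t" => dt (val_mul_bracketSq_ne_zero hF)
local notation "wx" => overF hF (pderiv 0 F)
local notation "wt" => overF hF (pderiv 1 F)

/-- As `ln F` is not known to lie in the algebra, `dt_dx` cannot be applied to it; instead `(P / F)
* F = P` is differentiated for both partial derivatives. -/
theorem dx_wt : ∂x wt = ∂t wx := by
  have h1 := congrArg ∂x (overF_mul hF (pderiv 1 F))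
  have h2 := congrArg ∂t (overF_mul hF (pderiv 0 F))
  simp only [Derivation.leibniz, dx_poly, dt_poly, smul_eq_mul, pderiv_one_pderiv_zero] at h1 h2
  have h3 := overF_mul hF (pderiv 0 F)
  have h4 := overF_mul hF (pderiv 1 F)
  rw [← sub_eq_zero]
  refine eq_zero_of_mul_poly F hF ?_
  linear_combination h1 - h2 + wt * h3 - wx * h4

theorem poly_logLaplace : poly (F * bracketSq) (logLaplace F) =
    poly (F * bracketSq) F ^ 2 * (∂x wx + ∂t wt) := by
  have h1 := congrArg ∂x (overF_mul hF (pderiv 0 F))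
  have h2 := congrArg ∂t (overF_mul hF (pderiv 1 F))
  simp only [Derivation.leibniz, dx_poly, dt_poly, smul_eq_mul] at h1 h2
  have h3 := overF_mul hF (pderiv 0 F)
  have h4 := overF_mul hF (pderiv 1 F)
  simp only [logLaplace, map_add, map_sub, map_mul, ← h1, ← h2, ← h3, ← h4]
  ring

theorem eq_zero_of_two_mul {G : MvPolynomial (Fin 2) ℝ} {f : ratAlg G} (h : 2 * f = 0) : f = 0 :=
  ratAlg_ext fun x t => by
    have := congrFun (congrFun (congrArg Subtype.val h) x) t
    simpa [two_mul] using this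

theorem derivation_ofNat {A : Type*} [CommRing A] [Algebra ℝ A] (d : Derivation ℝ A A) (n : ℕ)
    [n.AtLeastTwo] : d ofNat(n) = 0 := d.map_natCast n

theorem dx_bilinear_of_solvesSystem (h : SolvesSystem (uField F) (vField F)) :
    ∂x (3 * ∂t wt - 6 * (∂x wx * ∂x wx) + 3 * ∂x wx - ∂x (∂x (∂x wx))) = 0 := by
  have hu : uField F = (2 * ∂x wx : ratAlg (F * bracketSq)) := by
    ext x t
    simp [uField, pdx_logVal hF, coe_dx, two_mul]
  have hv : vField F = (-(2 * ∂x wt) : ratAlg (F * bracketSq)) := by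
    ext x t
    simp [vField, pdt_logVal hF, coe_dx, two_mul]
  have key : 3 * ∂t (-(2 * ∂x wt)) + 3 * ∂x ((2 * ∂x wx) ^ 2) - 3 * ∂x (2 * ∂x wx)
      + ∂x (∂x (∂x (2 * ∂x wx))) = 0 := by
    refine ratAlg_ext fun x t => ?_
    have h1 := (h x t).2
    rw [hu, hv] at h1
    change 3 * pdt _ x t + 3 * pdx _ x t - 3 * pdx _ x t + pdx (pdx (pdx _)) x t = 0
    have h2 : (((2 * ∂x wx) ^ 2 : ratAlg (F * bracketSq)) : ℝ → ℝ → ℝ) =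
      fun y s => ((2 * ∂x wx : ratAlg (F * bracketSq)) : ℝ → ℝ → ℝ) y s ^ 2 := rfl
    rw [h2]
    linear_combination 3 * h1
  simp only [Derivation.leibniz, Derivation.leibniz_pow, map_add, map_sub, map_neg,
    derivation_ofNat, smul_eq_mul, mul_zero, add_zero, dt_dx] at key ⊢
  -- The left side of `key` is `-2` times the desired expression.
  exact eq_zero_of_two_mul (by linear_combination -key)

end

end Boussinesq

namespace Boussinesq

open MvPolynomial

/-! ### The conservation law behind the dilations -/

/-- If `a = w_x` and `b = w_t` for a solution `w` of
`3 w_tt = 6 w_xx² - 3 w_xx + w_xxxx`, then `18 w_xt²` and `3 (w_xx + w_tt)` differ by a divergence.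
The multiplier is `w_x + x w_xx + 5 t w_xt`. -/
theorem eighteen_mul_sq_eq {A : Type*} [CommRing A] [Algebra ℝ A] (d e : Derivation ℝ A A)
    (hde : ∀ f, e (d f) = d (e f)) {a b x t : A} (hdx : d x = 1) (hex : e x = 0) (hdt : d t = 0)
    (het : e t = 1) (hab : d b = e a)
    (h : 3 * e b - 6 * (d a * d a) + 3 * d a - d (d (d a)) = 0) :
    18 * (e a * e a) = 3 * (e b + d a) - d (d (d a)) +
      d (6 * (a * d a) - 12 * (a * (d a * d a)) - 2 * (a * d (d (d a))) + 4 * (d a * d (d a))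
        - 3 * (x * (e a * e a)) + 3 * (x * (d a * d a)) - 8 * (x * (d a * (d a * d a)))
        - 2 * (x * (d a * d (d (d a)))) + x * (d (d a) * d (d a)) + 30 * (t * (e a * d a))
        - 60 * (t * (e a * (d a * d a))) - 10 * (t * (e a * d (d (d a))))
        + 10 * (t * (d (e a) * d (d a)))) +
      e (6 * (a * e a) + 6 * (x * (d a * e a)) + 15 * (t * (e a * e a)) - 15 * (t * (d a * d a))
        + 20 * (t * (d a * (d a * d a))) - 5 * (t * (d (d a) * d (d a)))) := by
  have hd := congrArg d h
  simp only [Derivation.leibniz, map_add, map_sub, map_zero, derivation_ofNat, smul_eq_mul,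
    mul_zero, add_zero, ← hde, hab] at hd
  simp only [Derivation.leibniz, map_add, map_sub, derivation_ofNat, smul_eq_mul, mul_zero,
    add_zero, ← hde, hdx, hex, hdt, het] at hd ⊢
  -- The multiplier is the `x`-derivative of the dilation generator `x w_x + 5t w_t`. It gives `18
  -- w_xt² - 6 w_xx²` as a divergence; subtracting `h` trades `6 w_xx²` for `3Δw - w_xxxx`.
  linear_combination (-2) * (a + x * d a + 5 * t * e a) * hd - h

/-! ### Decay of the logarithmic derivatives -/

section

variable {F : MvPolynomial (Fin 2) ℝ} (hF : ∀ x t, val F x t ≠ 0) {N : ℕ}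

theorem degLE_mul_bracketSq (hN : DegLE F N) : DegLE (F * bracketSq) (N + 2 : ℕ) :=
  (hN.mul degLE_bracketSq).mono (by push_cast; rfl)

theorem hasDecay_overF {P : MvPolynomial (Fin 2) ℝ} {k : ℤ} (hP : DegLE P (N - k)) :
    HasDecay (N + 2 : ℕ) k (overF hF P) :=
  HasDecay.of_frac ((hP.mul degLE_bracketSq).mono (by push_cast; linarith)) (frac_mul_poly _ _)

theorem hasDecay_ofNat {G : MvPolynomial (Fin 2) ℝ} (D : ℤ) (n : ℕ) [n.AtLeastTwo] :
    HasDecay D 0 (ofNat(n) : ratAlg G) :=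
  ⟨C (n : ℝ), 0, (degLE_C _).mono (by simp), by simp; rfl⟩

theorem HasDecay.mul_of_le {G : MvPolynomial (Fin 2) ℝ} {D k l j : ℤ} {f g : ratAlg G}
    (hf : HasDecay D k f) (hg : HasDecay D l g) (h : j ≤ k + l) : HasDecay D j (f * g) :=
  (hf.mul hg).mono h

theorem HasDecay.ofNat_mul {G : MvPolynomial (Fin 2) ℝ} {D k j : ℤ} {f : ratAlg G}
    (hf : HasDecay D k f) (n : ℕ) [n.AtLeastTwo] (h : j ≤ k) :
    HasDecay D j (ofNat(n) * f) := (hasDecay_ofNat D n).mul_of_le hf (by linarith)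

theorem natDegree_slice_bracketSq (t : ℝ) : (slice t bracketSq).natDegree = 2 := by
  have h : slice t bracketSq = Polynomial.X ^ 2 + Polynomial.C (1 + t ^ 2) := by
    simp [slice, bracketSq]
    ring
  rw [h]
  exact Polynomial.natDegree_X_pow_add_C

theorem natDegree_slice_mul_bracketSq (hN : ∀ t, (slice t F).natDegree = N) (hF0 : N ≠ 0) (t : ℝ) :
    (slice t (F * bracketSq)).natDegree = N + 2 := by
  rw [map_mul, Polynomial.natDegree_mul, hN, natDegree_slice_bracketSq]
  · intro h
    have := hN t
    rw [h] at this
    exact hF0 (by simpa using this.symm)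
  · intro h
    have := natDegree_slice_bracketSq t
    rw [h] at this
    simp at this

local notation "δx" => dx (val_mul_bracketSq_ne_zero hF)
local notation "δt" => dt (val_mul_bracketSq_ne_zero hF)
local notation "wx" => overF hF (pderiv 0 F)
local notation "wt" => overF hF (pderiv 1 F)

theorem bilinear_eq_zero (hN0 : N ≠ 0) (hN : DegLE F N) (hs : ∀ t, (slice t F).natDegree = N)
    (h : SolvesSystem (uField F) (vField F)) :
    3 * δt wt - 6 * (δx wx * δx wx) + 3 * δx wx - δx (δx (δx wx)) = 0 := by
  have hD := degLE_mul_bracketSq hN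
  refine eq_zero_of_dx_eq_zero (val_mul_bracketSq_ne_zero hF)
    (natDegree_slice_mul_bracketSq hs hN0) (k := 2) two_pos ?_ (dx_bilinear_of_solvesSystem hF h)
  have ha : HasDecay (N + 2 : ℕ) 1 wx := hasDecay_overF hF (hN.pderiv 0)
  have hb : HasDecay (N + 2 : ℕ) 1 wt := hasDecay_overF hF (hN.pderiv 1)
  have ha1 := ha.dx (val_mul_bracketSq_ne_zero hF) hD
  have hb1 := hb.dt (val_mul_bracketSq_ne_zero hF) hD
  have ha3 := (ha1.dx (val_mul_bracketSq_ne_zero hF) hD).dx (val_mul_bracketSq_ne_zero hF) hD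
  refine HasDecay.sub hD (HasDecay.add hD (HasDecay.sub hD ?_ ?_) ?_) (ha3.mono (by norm_num))
  · exact hb1.ofNat_mul 3 (by norm_num)
  · exact (ha1.mul ha1).ofNat_mul 6 (by norm_num)
  · exact ha1.ofNat_mul 3 (by norm_num)

/-- The equation expresses `3Δw` through `w_xx²` and `w_xxxx`, both of order 4: two orders better
than a generic second derivative of `w`. -/
theorem hasDecay_laplacian (hN0 : N ≠ 0) (hN : DegLE F N) (hs : ∀ t, (slice t F).natDegree = N)
    (h : SolvesSystem (uField F) (vField F)) :
    HasDecay (N + 2 : ℕ) 4 (3 * (δx wx + δt wt)) := by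
  have hD := degLE_mul_bracketSq hN
  have ha : HasDecay (N + 2 : ℕ) 1 wx := hasDecay_overF hF (hN.pderiv 0)
  have ha1 := ha.dx (val_mul_bracketSq_ne_zero hF) hD
  have ha3 := (ha1.dx (val_mul_bracketSq_ne_zero hF) hD).dx (val_mul_bracketSq_ne_zero hF) hD
  have heq : 3 * (δx wx + δt wt) = 6 * (δx wx * δx wx) + δx (δx (δx wx)) := by
    linear_combination bilinear_eq_zero hF hN0 hN hs h
  rw [heq]
  exact HasDecay.add hD ((ha1.mul ha1).ofNat_mul 6 (by norm_num)) (ha3.mono (by norm_num))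

end

/-! ### Degree drop for the numerator of the Laplacian, and the radial leading part of the gradient
-/

section

variable {F : MvPolynomial (Fin 2) ℝ} {N : ℕ}

theorem degLE_logLaplace (hF : ∀ x t, val F x t ≠ 0) (hN0 : N ≠ 0) (hN : DegLE F N)
    (hs : ∀ t, (slice t F).natDegree = N) (h : SolvesSystem (uField F) (vField F)) :
    DegLE (logLaplace F) (2 * N - 4) := by
  obtain ⟨P, m, hP, hm⟩ := hasDecay_laplacian hF hN0 hN hs h
  have h1 : C 3 * logLaplace F * (F * bracketSq) ^ m = F ^ 2 * P := by
    refine poly_injective (G := F * bracketSq) ?_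
    have h3 : poly (F * bracketSq) (C 3) = 3 := by simp; rfl
    rw [map_mul, map_mul, poly_logLaplace hF, map_pow, map_mul _ (F ^ 2), ← hm, h3, map_pow]
    ring
  have h2 : DegLE (C 3 * logLaplace F * (F * bracketSq) ^ m) (2 * N + (m * (N + 2 : ℕ) - 4)) :=
    h1 ▸ (hN.pow 2).mul_of_le hP (by push_cast; rfl)
  have hne : F * bracketSq ≠ 0 := fun h0 => by
    have := val_mul_bracketSq_ne_zero hF 0 0
    rw [h0] at this
    simp [val] at this
  -- Any slice bounds the total degree from below; `t = 0` is as good as another.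
  have h4 : m * (N + 2) ≤ ((F * bracketSq) ^ m).totalDegree := by
    have := natDegree_slice_le_totalDegree 0 ((F * bracketSq) ^ m)
    rwa [map_pow, Polynomial.natDegree_pow, natDegree_slice_mul_bracketSq hs hN0] at this
  have h5 := (h2.of_mul_right (pow_ne_zero m hne)).C_mul (1 / 3)
  rw [← mul_assoc, ← C_mul] at h5
  norm_num at h5
  refine h5.mono ?_
  have : ((m * (N + 2) : ℕ) : ℤ) ≤ ((F * bracketSq) ^ m).totalDegree := by exact_mod_cast h4
  push_cast at this ⊢
  linarith

/-- `F_{x_i} (1 + x² + t²) - N x_i F` has degree at most `N` if the form of degree `N` in `F` is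
a multiple of a power of `x² + t²`. -/
theorem degLE_pderiv_mul_bracketSq_sub {m : ℕ} {c : ℝ} (hm : m ≠ 0)
    (h : DegLE (F - C c * (X 0 ^ 2 + X 1 ^ 2) ^ m) (2 * m - 1)) (i : Fin 2) :
    DegLE (pderiv i F * bracketSq - C ((2 * m : ℕ) : ℝ) * (X i * F)) (2 * m : ℕ) := by
  set H : MvPolynomial (Fin 2) ℝ := C c * (X 0 ^ 2 + X 1 ^ 2) ^ m with hH
  set R := F - H with hR
  have hFR : F = H + R := by rw [hR]; ring
  have hQ := degLE_X_sq_add 2 le_rfl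
  have hHd : DegLE H (2 * m) := ((hQ.pow m).C_mul c).mono (by linarith)
  -- The gradient of a radial form is radial, so the degree `2m + 1` parts cancel exactly.
  have hrad : pderiv i H * (X 0 ^ 2 + X 1 ^ 2) = C ((2 * m : ℕ) : ℝ) * (X i * H) := by
    obtain ⟨k, rfl⟩ := Nat.exists_eq_succ_of_ne_zero hm
    have hp : pderiv i (X 0 ^ 2 + X 1 ^ 2 : MvPolynomial (Fin 2) ℝ) = 2 * X i := by
      fin_cases i <;> simp [pderiv_X]
    rw [hH, pderiv_C_mul, pderiv_pow, hp]
    have h2 : (C 2 : MvPolynomial (Fin 2) ℝ) = 2 := rfl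
    simp [h2]
    ring
  have key : pderiv i F * bracketSq - C ((2 * m : ℕ) : ℝ) * (X i * F) = pderiv i H +
      (pderiv i R * bracketSq - C ((2 * m : ℕ) : ℝ) * (X i * R)) := by
    have hq : bracketSq = 1 + (X 0 ^ 2 + X 1 ^ 2) := by rw [bracketSq]; ring
    rw [hFR, map_add, hq]
    linear_combination hrad
  rw [key]
  refine ((hHd.pderiv i).mono ?_).add (((h.pderiv i).mul_of_le degLE_bracketSq ?_).sub
    (((degLE_X i).mul_of_le h ?_).C_mul _))
  all_goals push_cast; linarith

end

end Boussinesq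

namespace Boussinesq

open MvPolynomial

/-! ### The flux at infinity and the value of the integral -/

section

variable {F : MvPolynomial (Fin 2) ℝ} (hF : ∀ x t, val F x t ≠ 0)

/-- The function `1 / (1 + x² + t²)`. -/
noncomputable def invBracketSq : ratAlg (F * bracketSq) := frac (val_mul_bracketSq_ne_zero hF) F

theorem coe_invBracketSq (x t : ℝ) :
    (invBracketSq hF : ℝ → ℝ → ℝ) x t = (1 + x ^ 2 + t ^ 2)⁻¹ := by
  have h : (1 + x ^ 2 + t ^ 2) ≠ 0 := by positivity
  have := hF x t
  simp only [invBracketSq, frac, val_mul, val_bracketSq]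
  field_simp

theorem invBracketSq_mul : invBracketSq hF * poly (F * bracketSq) bracketSq = 1 :=
  ratAlg_ext fun x t => by
    have h : (1 + x ^ 2 + t ^ 2) ≠ 0 := by positivity
    simp [coe_invBracketSq, coe_poly, val_bracketSq, h]

local notation "δx" => dx (val_mul_bracketSq_ne_zero hF)
local notation "δt" => dt (val_mul_bracketSq_ne_zero hF)
local notation "wx" => overF hF (pderiv 0 F)
local notation "wt" => overF hF (pderiv 1 F)
local notation "ρ" => invBracketSq hF
local notation "ξ" => poly (F * bracketSq) (X 0)
local notation "τ" => poly (F * bracketSq) (X 1)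

theorem dx_fst : δx ξ = 1 := by rw [dx_poly, pderiv_X_self, map_one]

theorem dt_fst : δt ξ = 0 := by simp [dt_poly, pderiv_X]

theorem dx_snd : δx τ = 0 := by simp [dx_poly, pderiv_X]

theorem dt_snd : δt τ = 1 := by rw [dt_poly, pderiv_X_self, map_one]

/-- The field `(x,t)/(1+r²)` is a model for `∇ ln r` that is smooth at the origin; its divergence
has the explicit integral `2π`. -/
theorem divergence_mul_invBracketSq : δx (ξ * ρ) + δt (τ * ρ) = 2 * (ρ * ρ) := by
  have hq : poly (F * bracketSq) bracketSq = 1 + ξ * ξ + τ * τ := by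
    have : bracketSq = 1 + X 0 * X 0 + X 1 * X 1 := by rw [bracketSq]; ring
    exact (congrArg (poly (F * bracketSq)) this).trans (by simp)
  have h := invBracketSq_mul hF
  rw [hq] at h
  have h1 := congrArg δx h
  have h2 := congrArg δt h
  simp only [Derivation.leibniz, map_add, smul_eq_mul, dx_fst hF, dt_fst hF, dx_snd hF,
    dt_snd hF, mul_zero, add_zero, mul_one, zero_add, Derivation.map_one_eq_zero] at h1 h2 ⊢
  linear_combination (-δx ρ * ξ - δt ρ * τ - 2 * ρ) * h + ρ * ξ * h1 + ρ * τ * h2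

variable {m : ℕ} {c : ℝ}

theorem hasDecay_overF_pderiv_sub (hm : m ≠ 0)
    (h : DegLE (F - C c * (X 0 ^ 2 + X 1 ^ 2) ^ m) (2 * m - 1)) (i : Fin 2) :
    HasDecay (2 * m + 2 : ℕ) 2
      (overF hF (pderiv i F) - ((2 * m : ℕ) : ratAlg (F * bracketSq)) *
        (poly (F * bracketSq) (X i) * ρ)) := by
  refine HasDecay.of_frac ((degLE_pderiv_mul_bracketSq_sub hm h i).mono (by push_cast; linarith)) ?_
  have h1 : overF hF (pderiv i F) * poly (F * bracketSq) (F * bracketSq) =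
      poly (F * bracketSq) (pderiv i F * bracketSq) := frac_mul_poly _ _
  have h2 : ρ * poly (F * bracketSq) (F * bracketSq) = poly (F * bracketSq) F := frac_mul_poly _ _
  have h3 : poly (F * bracketSq) (C ((2 * m : ℕ) : ℝ)) =
      ((2 * m : ℕ) : ratAlg (F * bracketSq)) := by
    rw [map_natCast C, map_natCast]
  rw [map_sub, ← h1, map_mul _ (C _), map_mul _ (X i) F, h3, ← h2]
  ring

/-- The field `3∇w` has order 1, too slow for its divergence to integrate to zero. Subtracting
`3N(x,t)/(1+r²)` leaves order 2 and extracts the explicit density `6N/(1+r²)²`. All other flux terms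
have order at least 3, even those weighted by `x` or `t`. -/
theorem exists_flux (hm : m ≠ 0) (hN : DegLE F (2 * m : ℕ))
    (htop : DegLE (F - C c * (X 0 ^ 2 + X 1 ^ 2) ^ m) (2 * m - 1))
    (h : 3 * δt wt - 6 * (δx wx * δx wx) + 3 * δx wx - δx (δx (δx wx)) = 0) :
    ∃ P Q : ratAlg (F * bracketSq), HasDecay (2 * m + 2 : ℕ) 2 P ∧ HasDecay (2 * m + 2 : ℕ) 2 Q ∧
      18 * (δt wx * δt wx) = 6 * (((2 * m : ℕ) : ratAlg (F * bracketSq)) * (ρ * ρ)) +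
        (δx P + δt Q) := by
  have hG := val_mul_bracketSq_ne_zero hF
  have key := eighteen_mul_sq_eq δx δt (dt_dx hG) (dx_fst hF) (dt_fst hF) (dx_snd hF) (dt_snd hF)
    (dx_wt hF) h
  have hdiv := divergence_mul_invBracketSq hF
  have hD := degLE_mul_bracketSq hN
  have d0 := hasDecay_overF_pderiv_sub hF hm htop 0
  have d1 := hasDecay_overF_pderiv_sub hF hm htop 1
  have hx : HasDecay (2 * m + 2 : ℕ) (-1) ξ := HasDecay.of_poly _ (degLE_X 0)
  have ht : HasDecay (2 * m + 2 : ℕ) (-1) τ := HasDecay.of_poly _ (degLE_X 1)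
  have ha : HasDecay (2 * m + 2 : ℕ) 1 wx := hasDecay_overF hF (hN.pderiv 0)
  have a1 := ha.dx hG hD
  have a2 := a1.dx hG hD
  have a3 := a2.dx hG hD
  have b1 := ha.dt hG hD
  have b2 := b1.dx hG hD
  refine ⟨3 * (wx - ((2 * m : ℕ) : ratAlg (F * bracketSq)) * (ξ * ρ)) - δx (δx wx) +
    (6 * (wx * δx wx) - 12 * (wx * (δx wx * δx wx)) - 2 * (wx * δx (δx (δx wx)))
        + 4 * (δx wx * δx (δx wx))
        - 3 * (ξ * (δt wx * δt wx)) + 3 * (ξ * (δx wx * δx wx))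
        - 8 * (ξ * (δx wx * (δx wx * δx wx)))
        - 2 * (ξ * (δx wx * δx (δx (δx wx)))) + ξ * (δx (δx wx) * δx (δx wx))
        + 30 * (τ * (δt wx * δx wx))
        - 60 * (τ * (δt wx * (δx wx * δx wx))) - 10 * (τ * (δt wx * δx (δx (δx wx))))
        + 10 * (τ * (δx (δt wx) * δx (δx wx)))),
    3 * (wt - ((2 * m : ℕ) : ratAlg (F * bracketSq)) * (τ * ρ)) +
    (6 * (wx * δt wx) + 6 * (ξ * (δx wx * δt wx)) + 15 * (τ * (δt wx * δt wx))
        - 15 * (τ * (δx wx * δx wx))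
        + 20 * (τ * (δx wx * (δx wx * δx wx))) - 5 * (τ * (δx (δx wx) * δx (δx wx)))),
    ?_, ?_, ?_⟩
  · refine .add hD (.sub hD (d0.ofNat_mul 3 le_rfl) (a2.mono (by norm_num)))
      (.add hD (.sub hD (.sub hD (.add hD (.add hD (.sub hD (.sub hD (.add hD (.sub hD
      (.add hD (.sub hD (.sub hD ?_ ?_) ?_) ?_) ?_) ?_) ?_) ?_) ?_) ?_) ?_) ?_) ?_)
    · exact (ha.mul a1).ofNat_mul 6 (by norm_num)
    · exact (ha.mul (a1.mul a1)).ofNat_mul 12 (by norm_num)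
    · exact (ha.mul a3).ofNat_mul 2 (by norm_num)
    · exact (a1.mul a2).ofNat_mul 4 (by norm_num)
    · exact (hx.mul (b1.mul b1)).ofNat_mul 3 (by norm_num)
    · exact (hx.mul (a1.mul a1)).ofNat_mul 3 (by norm_num)
    · exact (hx.mul (a1.mul (a1.mul a1))).ofNat_mul 8 (by norm_num)
    · exact (hx.mul (a1.mul a3)).ofNat_mul 2 (by norm_num)
    · exact (hx.mul (a2.mul a2)).mono (by norm_num)
    · exact (ht.mul (b1.mul a1)).ofNat_mul 30 (by norm_num)
    · exact (ht.mul (b1.mul (a1.mul a1))).ofNat_mul 60 (by norm_num)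
    · exact (ht.mul (b1.mul a3)).ofNat_mul 10 (by norm_num)
    · exact (ht.mul (b2.mul a2)).ofNat_mul 10 (by norm_num)
  · refine .add hD (d1.ofNat_mul 3 le_rfl)
      (.sub hD (.add hD (.sub hD (.add hD (.add hD ?_ ?_) ?_) ?_) ?_) ?_)
    · exact (ha.mul b1).ofNat_mul 6 (by norm_num)
    · exact (hx.mul (a1.mul b1)).ofNat_mul 6 (by norm_num)
    · exact (ht.mul (b1.mul b1)).ofNat_mul 15 (by norm_num)
    · exact (ht.mul (a1.mul a1)).ofNat_mul 15 (by norm_num)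
    · exact (ht.mul (a1.mul (a1.mul a1))).ofNat_mul 20 (by norm_num)
    · exact (ht.mul (a2.mul a2)).ofNat_mul 5 (by norm_num)
  · have hc : ∀ d : Derivation ℝ (ratAlg (F * bracketSq)) (ratAlg (F * bracketSq)), ∀ f g,
        d (3 * (f - ((2 * m : ℕ) : ratAlg (F * bracketSq)) * g)) =
          3 * (d f - ((2 * m : ℕ) : ratAlg (F * bracketSq)) * d g) := fun d f g => by
      rw [Derivation.leibniz, map_sub, Derivation.leibniz, Derivation.map_natCast,
        derivation_ofNat]
      simp only [smul_eq_mul, mul_zero, add_zero]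
    rw [map_add, map_add δt, map_sub, hc, hc, key]
    linear_combination (3 * ((2 * m : ℕ) : ratAlg (F * bracketSq))) * hdiv

theorem integral_sq_dt_wx (hm : m ≠ 0) (hc : c ≠ 0) (hN : DegLE F (2 * m : ℕ))
    (htop : DegLE (F - C c * (X 0 ^ 2 + X 1 ^ 2) ^ m) (2 * m - 1))
    (h : 3 * δt wt - 6 * (δx wx * δx wx) + 3 * δx wx - δx (δx (δx wx)) = 0) :
    Integrable (fun p : ℝ × ℝ => (δt wx : ℝ → ℝ → ℝ) p.1 p.2 ^ 2) ∧
      ∫ p : ℝ × ℝ, (δt wx : ℝ → ℝ → ℝ) p.1 p.2 ^ 2 = 2 * m * Real.pi / 3 := by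
  have hG := val_mul_bracketSq_ne_zero hF
  have hD := degLE_mul_bracketSq hN
  obtain ⟨ε, hε, hlow⟩ := exists_bracket_pow_le hF hc htop
  have hlow' : ∀ x t, ε * bracket x t ^ (2 * m + 2) ≤ |val (F * bracketSq) x t| := fun x t => by
    rw [val_mul, val_bracketSq, ← bracket_sq, abs_mul, abs_of_nonneg (sq_nonneg (bracket x t)),
      pow_add, ← mul_assoc]
    exact mul_le_mul_of_nonneg_right (hlow x t) (sq_nonneg _)
  have ha : HasDecay (2 * m + 2 : ℕ) 1 wx := hasDecay_overF hF (hN.pderiv 0)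
  have hb := ha.dt hG hD
  have hρ : HasDecay (2 * m + 2 : ℕ) 2 ρ :=
    HasDecay.of_frac (hN.mono (by push_cast; linarith)) (frac_mul_poly _ _)
  have hint : Integrable fun p : ℝ × ℝ => (δt wx : ℝ → ℝ → ℝ) p.1 p.2 ^ 2 := by
    have := ((hb.mul hb).mono (by norm_num)).integrable hε hlow'
    simpa [sq] using this
  refine ⟨hint, ?_⟩
  obtain ⟨P, Q, hP, hQ, hPQ⟩ := exists_flux hF hm hN htop h
  have hpt : ∀ p : ℝ × ℝ, (δt wx : ℝ → ℝ → ℝ) p.1 p.2 ^ 2 =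
      2 * m / 3 * ((1 + p.1 ^ 2 + p.2 ^ 2) ^ 2)⁻¹ + ((1 / 18) * (δx P : ℝ → ℝ → ℝ) p.1 p.2 +
        (1 / 18) * (δt Q : ℝ → ℝ → ℝ) p.1 p.2) := fun p => by
    have h1 := congrFun (congrFun (congrArg Subtype.val hPQ) p.1) p.2
    have h2 : 18 * ((δt wx : ℝ → ℝ → ℝ) p.1 p.2 * (δt wx : ℝ → ℝ → ℝ) p.1 p.2) =
        6 * (((2 * m : ℕ) : ℝ) * ((ρ : ℝ → ℝ → ℝ) p.1 p.2 * (ρ : ℝ → ℝ → ℝ) p.1 p.2)) +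
        ((δx P : ℝ → ℝ → ℝ) p.1 p.2 + (δt Q : ℝ → ℝ → ℝ) p.1 p.2) := h1
    rw [coe_invBracketSq, ← mul_inv, ← sq, ← sq] at h2
    push_cast at h2
    linarith
  have iρ : Integrable fun p : ℝ × ℝ => ((1 + p.1 ^ 2 + p.2 ^ 2) ^ 2)⁻¹ := by
    have := ((hρ.mul hρ).mono (by norm_num)).integrable hε hlow'
    simpa [coe_invBracketSq, sq] using this
  have iP := (hP.dx hG hD).integrable hε hlow'
  have iQ := (hQ.dt hG hD).integrable hε hlow'
  have iPQ : Integrable fun p : ℝ × ℝ => (1 / 18) * (δx P : ℝ → ℝ → ℝ) p.1 p.2 +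
      (1 / 18) * (δt Q : ℝ → ℝ → ℝ) p.1 p.2 := (iP.const_mul _).add (iQ.const_mul _)
  rw [integral_congr_ae (ae_of_all _ hpt), integral_add (iρ.const_mul _) iPQ,
    integral_add (iP.const_mul _) (iQ.const_mul _), integral_const_mul, integral_const_mul,
    integral_const_mul, integral_inv_one_add_sq_sq, hP.integral_dx_eq_zero hε hlow' hG hD,
    hQ.integral_dt_eq_zero hε hlow' hG hD]
  ring

theorem vField_eq : vField F = (-(δt wx + δt wx) : ratAlg (F * bracketSq)) := by
  ext x t
  rw [← dx_wt]
  simp [vField, pdt_logVal hF, coe_dx]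
  ring

end

end Boussinesq

/-! ### Assembly of the main theorem -/

theorem mainTheorem2 (n : ℕ) (hn : 1 ≤ n) (F : MvPolynomial (Fin 2) ℝ)
    (hF : Boussinesq.IsRationalSolution n F) :
    Integrable (fun p : ℝ × ℝ => Boussinesq.vField F p.1 p.2 ^ 2) ∧
      1 / (8 * Real.pi) * ∫ t : ℝ, ∫ x : ℝ, Boussinesq.vField F x t ^ 2 =
        (n : ℝ) * ((n : ℝ) + 1) / 6 := by
  open Boussinesq MvPolynomial in
  have h2N : 2 ≤ n * (n + 1) := by nlinarith
  have hF0 : F ≠ 0 := by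
    rintro rfl
    exact hF.ne_zero 0 0 (by simp [val])
  have hdeg : DegLE F (n * (n + 1) : ℕ) := hF.totalDegree ▸ degLE_totalDegree F
  have hs := natDegree_slice (by omega) hF.degree_x hF.totalDegree
  have hbil := bilinear_eq_zero hF.ne_zero (by omega) hdeg hs hF.solves
  have hlap := degLE_logLaplace hF.ne_zero (by omega) hdeg hs hF.solves
  have htop0 := logLaplace_homogeneousComponent (F := F) (by rw [hF.totalDegree]; exact h2N)
    (by rw [hF.totalDegree]; exact hlap)
  obtain ⟨m, c, hm, hc, hH⟩ := logLaplace_eq_zero_of_isHomogeneous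
    (homogeneousComponent_isHomogeneous _ F) (homogeneousComponent_totalDegree_ne_zero hF0) htop0
  have htop := degLE_sub_homogeneousComponent F
  rw [hH, hm] at htop
  rw [hF.totalDegree] at hm
  rw [hm] at hdeg
  obtain ⟨hint, hval⟩ := integral_sq_dt_wx hF.ne_zero (by omega) hc hdeg
    (by simpa using htop) hbil
  have hv : ∀ x t, vField F x t ^ 2 = 4 *
      ((dt (val_mul_bracketSq_ne_zero hF.ne_zero) (overF hF.ne_zero (pderiv 0 F)) :
        ratAlg (F * bracketSq)) : ℝ → ℝ → ℝ) x t ^ 2 := fun x t => by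
    rw [vField_eq hF.ne_zero]
    simp
    ring
  have hint' : Integrable (fun p : ℝ × ℝ => vField F p.1 p.2 ^ 2) := by
    simp only [hv]
    exact hint.const_mul 4
  refine ⟨hint', ?_⟩
  have hfub : ∫ t : ℝ, ∫ x : ℝ, vField F x t ^ 2 = ∫ p : ℝ × ℝ, vField F p.1 p.2 ^ 2 := by
    rw [Measure.volume_eq_prod, integral_prod_symm _ (by rwa [← Measure.volume_eq_prod])]
  have hm' : (n : ℝ) * ((n : ℝ) + 1) = 2 * m := by exact_mod_cast hm
  rw [hfub]
  simp only [hv]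
  rw [integral_const_mul, hval, hm']
  have := Real.pi_ne_zero
  field_simp
  ring
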